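/- Throughout, $\log$ is the logarithm to base two and $\Sigma=\{0,1\}$. **Notation.** For $x=x_1\cdots x_n\in\Sigma^n$, let $\mathcal B(x)\subseteq\Sigma^{n-1}$ be the set of all sequences obtained from $x$ by deleting exactly one symbol and then changing at most one symbol. A code $\mathcal C\subseteq\Sigma^n$ is an $(n,N;\mathcal B)$-reconstruction code if $|\mathcal B(x)\cap\mathcal B(y)|<N$ for all distinct $x,y\in\mathcal C$; its redundancy is $\mathrm{red}(\mathcal C)=n-\log|\mathcal C|$. Put $\mathrm{wt}(x)=\sum_i x_i$, $\mathrm{VT}^0(x)=\mathrm{wt}(x)$ and $\mathrm{VT}^k(x)=\sum_{i=1}^n\sum_{j=1}^i j^{k-1}x_i$ for $k\ge1$. With $x_0=x_{n+1}=0$, the differential sequence $\psi(x)\in\Sigma^{n+1}$ has entries $\psi(x)_i\equiv x_i-x_{i-1}\pmod 2$, $1\le i\le n+1$. A sequence is strong-$(l,\epsilon)$-locally-balanced if each of its substrings (of consecutive symbols) of length $l'\ge l$ has weight between $(\frac12-\epsilon)l'$ and $(\frac12+\epsilon)l'$. The period of a sequence $u$ is the least $p\ge 1$ with $u_i=u_{i+p}$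 for all $1\le i\le |u|-p$; $\mathcal R(n,t',t)$ is the set of $x\in\Sigma^n$ all of whose substrings of period at most $t'$ have length at most $t$. For a positive integer $P$, cut $x\in\Sigma^n$ into consecutive blocks $x^{(P,1)},x^{(P,2)},\dots$ of length $P$, the block with index $\lfloor n/P\rfloor+1$ being the (possibly empty) remainder and all later blocks being empty. **Theorem.** Let $n\ge10$, $\epsilon=\frac1{18}$, $l=\lceil1296\log n\rceil$, $P=4l$, $t=\lceil\log n\rceil+3$, and let $\mathcal M$ be the set of $x\in\Sigma^n$ such that $x$ and $\psi(x)$ are both strong-$(l,\epsilon)$-locally-balanced. For integers $s_0\in[0,3]$, $s_1\in[0,3n]$, $h_0\in[0,6]$, $h_1\in[0,6(n+1)]$ and $g_k,g_k'\in[0,3(2P)^k-1]$ for $k\in\{1,2,3\}$, let $\mathcal C(n,9,\mathcal B)$ be the set of all $x\in\Sigma^n$ such that - $x\in\mathcal M\cap\mathcal R(n,2,t)$; - $\mathrm{VT}^0(x)\equiv s_0\pmod 4$ and $\mathrm{VT}^1(x)\equiv s_1\pmod{3n+1}$; - $\mathrm{VT}^0(\psi(x))\equiv h_0\pmod 7$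 and $\mathrm{VT}^1(\psi(x))\equiv h_1\pmod{6(n+1)+1}$; - $\sum_{i\ge1}\mathrm{VT}^k\big(x^{(P,2i-1)}x^{(P,2i)}\big)\equiv g_k\pmod{3(2P)^k}$ for $k\in\{1,2,3\}$; - $\sum_{i\ge1}\mathrm{VT}^k\big(x^{(P,2i)}x^{(P,2i+1)}\big)\equiv g_k'\pmod{3(2P)^k}$ for $k\in\{1,2,3\}$. Then, for every choice of these integers, $\mathcal C(n,9,\mathcal B)$ is an $(n,9;\mathcal B)$-reconstruction code. Moreover, there is an absolute constant $K$ such that for every $n\ge10$ the integers $s_0,s_1,h_0,h_1,g_k,g_k'$ can be chosen in the above ranges so that $\mathcal C(n,9,\mathcal B)$ is nonempty and $$\mathrm{red}(\mathcal C(n,9,\mathcal B))\le 2\log n+12\log\log n+K.$$ -/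

import Mathlib

/-! Binary sequences are lists of Booleans (`true` is `1`); `Σ^n` is the set of lists of length `n`. -/

namespace DelSub

/-- The number of ones of a sequence. -/
def wt (x : List Bool) : ℕ := x.count true

/-- The number of coordinates where two sequences (of equal length) differ. -/
def hamming (x y : List Bool) : ℕ := (x.zip y).countP (fun p => p.1 != p.2)

/-- The single-deletion ball: the subsequences that are shorter by one. -/
def delBall (x : List Bool) : Set (List Bool) :=
  {y | y.length + 1 = x.length ∧ List.Sublist y x}

/-- The single-substitution ball: the sequences of the same length at Hamming distance at most one. -/
def subBall (x : List Bool) : Set (List Bool) :=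
  {y | y.length = x.length ∧ hamming x y ≤ 1}

/-- The single-deletion single-substitution ball. -/
def ball (x : List Bool) : Set (List Bool) :=
  {z | ∃ w ∈ delBall x, z ∈ subBall w}

/-- `(n, N; ball)`-reconstruction codes. -/
def IsReconstructionCode (n N : ℕ) (C : Set (List Bool)) : Prop :=
  (∀ x ∈ C, x.length = n) ∧
    ∀ x ∈ C, ∀ y ∈ C, x ≠ y → (ball x ∩ ball y).encard < N

/-- The redundancy `n - log₂ |C|` of a code `C ⊆ Σ^n`. -/
noncomputable def redundancy (n : ℕ) (C : Set (List Bool)) : ℝ :=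
  (n : ℝ) - Real.logb 2 (C.ncard : ℝ)

/-- The `k`-th order VT syndrome. The index `i` starts at `0`, so that `x.getD i false` is the
`(i+1)`-st entry, with coefficient `1 ^ (k-1) + ⋯ + (i+1) ^ (k-1)` for `k ≥ 1`. -/
def VT : ℕ → List Bool → ℕ
  | 0, x => wt x
  | k + 1, x => ∑ i ∈ Finset.range x.length,
      ∑ j ∈ Finset.Icc 1 (i + 1), j ^ k * (x.getD i false).toNat

/-- The differential sequence `(x_i - x_{i-1} mod 2)` for `1 ≤ i ≤ n + 1`,
where `x_0 = x_{n+1} = 0`. -/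
def diffSeq (x : List Bool) : List Bool :=
  List.zipWith Bool.xor (x ++ [false]) (false :: x)

/-- Strong `(l, ε)`-locally balanced: every substring of length `l' ≥ l` has weight between
`(1/2 - ε) l'` and `(1/2 + ε) l'`. -/
def StrongLocallyBalanced (l : ℕ) (ε : ℝ) (x : List Bool) : Prop :=
  ∀ i l' : ℕ, l ≤ l' → i + l' ≤ x.length →
    (1 / 2 - ε) * (l' : ℝ) ≤ (wt ((x.drop i).take l') : ℝ) ∧
      (wt ((x.drop i).take l') : ℝ) ≤ (1 / 2 + ε) * (l' : ℝ)

/-- `u` has period `p`: `p` is the smallest positive shift that preserves the entries. -/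
def HasPeriod (u : List Bool) (p : ℕ) : Prop :=
  IsLeast {q : ℕ | 0 < q ∧ ∀ i, i + q < u.length → u[i]? = u[i + q]?} p

/-- The sequences of length `n` all of whose substrings of period at most `t'` have
length at most `t`. -/
def boundedPeriodic (n t' t : ℕ) : Set (List Bool) :=
  {x | x.length = n ∧ ∀ u, List.IsInfix u x → (∃ p ≤ t', HasPeriod u p) → u.length ≤ t}

/-- The `i`-th block (`i ≥ 1`) of length `P` of `x`; the last nonempty one may be shorter, and all
later ones are empty. -/
def block (P : ℕ) (x : List Bool) (i : ℕ) : List Bool :=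
  (x.drop ((i - 1) * P)).take P

/-- The sum of the syndromes of the pairs of blocks `(1,2), (3,4), …`. -/
def oddPairVT (P k : ℕ) (x : List Bool) : ℕ :=
  ∑ i ∈ Finset.Icc 1 (x.length / P + 1), VT k (block P x (2 * i - 1) ++ block P x (2 * i))

/-- The sum of the syndromes of the pairs of blocks `(2,3), (4,5), …`. -/
def evenPairVT (P k : ℕ) (x : List Bool) : ℕ :=
  ∑ i ∈ Finset.Icc 1 (x.length / P + 1), VT k (block P x (2 * i) ++ block P x (2 * i + 1))

/-- The window length `l = ⌈1296 log₂ n⌉`. -/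
noncomputable def winLen (n : ℕ) : ℕ := ⌈1296 * Real.logb 2 (n : ℝ)⌉₊

/-- The block length `P = 4 l`. -/
noncomputable def blockLen (n : ℕ) : ℕ := 4 * winLen n

/-- The sequences `x` of length `n` such that `x` and its differential sequence are
strong `(l, 1/18)`-locally balanced. -/
def balancedSet (n : ℕ) : Set (List Bool) :=
  {x | x.length = n ∧ StrongLocallyBalanced (winLen n) (1 / 18) x ∧
    StrongLocallyBalanced (winLen n) (1 / 18) (diffSeq x)}

/-- The residues that define one code. Here `g k` and `g' k`, for `k : Fin 3`, are the residues
of the block constraints of order `k + 1`. -/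
structure Params where
  s₀ : ℕ
  s₁ : ℕ
  h₀ : ℕ
  h₁ : ℕ
  g : Fin 3 → ℕ
  g' : Fin 3 → ℕ

/-- The residues lie in their ranges. -/
def Params.InRange (n : ℕ) (p : Params) : Prop :=
  p.s₀ ≤ 3 ∧ p.s₁ ≤ 3 * n ∧ p.h₀ ≤ 6 ∧ p.h₁ ≤ 6 * (n + 1) ∧
    ∀ k : Fin 3, p.g k < 3 * (2 * blockLen n) ^ (k.val + 1) ∧
      p.g' k < 3 * (2 * blockLen n) ^ (k.val + 1)

/-- The code `C(n, 9, ball)` with the given residues, where `t = ⌈log₂ n⌉ + 3`. -/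
def code (n : ℕ) (p : Params) : Set (List Bool) :=
  {x | x ∈ balancedSet n ∧
    x ∈ boundedPeriodic n 2 (⌈Real.logb 2 (n : ℝ)⌉₊ + 3) ∧
    VT 0 x ≡ p.s₀ [MOD 4] ∧
    VT 1 x ≡ p.s₁ [MOD 3 * n + 1] ∧
    VT 0 (diffSeq x) ≡ p.h₀ [MOD 7] ∧
    VT 1 (diffSeq x) ≡ p.h₁ [MOD 6 * (n + 1) + 1] ∧
    ∀ k : Fin 3,
      oddPairVT (blockLen n) (k.val + 1) x ≡ p.g k [MOD 3 * (2 * blockLen n) ^ (k.val + 1)] ∧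
      evenPairVT (blockLen n) (k.val + 1) x ≡ p.g' k [MOD 3 * (2 * blockLen n) ^ (k.val + 1)]}

end DelSub

/-!
Writing a common word of the balls around `x` and `y` as the outcome of one deletion and at most one
substitution on either side aligns `x` with `y` up to two deletions and two substitutions. Such an
alignment changes each syndrome by less than its modulus, so the congruences become equalities. If
`x` and `y` differ only inside two consecutive blocks, then the difference of their suffix sums has
vanishing moments of orders zero, one and two there but changes sign at most twice, which forces
`x = y`. If they differ over a long range, the equalities of weights and first moments for the words
and for their differential sequences, together with local balance, keep the substitutions far from
the deletions; as a long window of period at most two is excluded, at most four pairs of deletions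
remain. Each pair accounts for at most two common words, so there are at most eight.

For the redundancy, the Chernoff bound and the union bound show that at least half of all words
satisfy the constraints that do not involve residues, and the pigeonhole principle is applied to the
`O(n ^ 2 * (log n) ^ 12)` tuples of residues.
-/

namespace DelSub

/-! ### Integer sequences -/

/-- The sequence `a` without its entry at `d`: the later entries move down by one place. -/
def deleteAt (a : ℕ → ℤ) (d i : ℕ) : ℤ := if i < d then a i else a (i + 1)

/-- The size of the jump of `a` between the places `i` and `i + 1`. For a binary sequence this is
the entry `i + 1` of its differential sequence. -/
def jump (a : ℕ → ℤ) (i : ℕ) : ℤ := |a i - a (i + 1)|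

/-- The sum of the entries of `a` at the places `j, …, N - 1`. -/
def suffixSum (N : ℕ) (a : ℕ → ℤ) (j : ℕ) : ℤ := ∑ i ∈ Finset.Ico j N, a i

/-- The first moment `∑ i * a i` over the places `i < N`. -/
def firstMoment (N : ℕ) (a : ℕ → ℤ) : ℤ := ∑ i ∈ Finset.range N, (i : ℤ) * a i

section Sequences

variable {N d i j : ℕ}

theorem deleteAt_of_lt (a : ℕ → ℤ) (h : i < d) : deleteAt a d i = a i := if_pos h

theorem deleteAt_of_le (a : ℕ → ℤ) (h : d ≤ i) : deleteAt a d i = a (i + 1) := if_neg h.not_gt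

theorem suffixSum_add (N : ℕ) (a b : ℕ → ℤ) (j : ℕ) :
    suffixSum N (a + b) j = suffixSum N a j + suffixSum N b j :=
  Finset.sum_add_distrib

theorem suffixSum_sub (N : ℕ) (a b : ℕ → ℤ) (j : ℕ) :
    suffixSum N (a - b) j = suffixSum N a j - suffixSum N b j :=
  Finset.sum_sub_distrib ..

theorem suffixSum_single (h : i < N) (c : ℤ) (j : ℕ) :
    suffixSum N (Pi.single i c) j = if j ≤ i then c else 0 := by
  simp [suffixSum, h]

theorem firstMoment_add (N : ℕ) (a b : ℕ → ℤ) :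
    firstMoment N (a + b) = firstMoment N a + firstMoment N b := by
  simp only [firstMoment, Pi.add_apply, mul_add, Finset.sum_add_distrib]

theorem firstMoment_sub (N : ℕ) (a b : ℕ → ℤ) :
    firstMoment N (a - b) = firstMoment N a - firstMoment N b := by
  simp only [firstMoment, Pi.sub_apply, mul_sub, Finset.sum_sub_distrib]

theorem firstMoment_single (h : i < N) (c : ℤ) : firstMoment N (Pi.single i c) = i * c := by
  rw [firstMoment, Finset.sum_eq_single i]
  · rw [Pi.single_eq_same]
  · intro k _ hk
    rw [Pi.single_eq_of_ne hk, mul_zero]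
  · simp [h]

theorem suffixSum_eq_add (h : j < N) (a : ℕ → ℤ) :
    suffixSum N a j = a j + suffixSum N a (j + 1) :=
  Finset.sum_eq_sum_Ico_succ_bot h a

theorem suffixSum_succ_top (h : j ≤ N) (a : ℕ → ℤ) :
    suffixSum (N + 1) a j = suffixSum N a j + a N :=
  Finset.sum_Ico_succ_top h a

theorem suffixSum_eq_sum_Ico_add {k : ℕ} (hjk : j ≤ k) (hk : k ≤ N) (a : ℕ → ℤ) :
    suffixSum N a j = ∑ i ∈ Finset.Ico j k, a i + suffixSum N a k :=
  (Finset.sum_Ico_consecutive a hjk hk).symm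

theorem firstMoment_succ_top (N : ℕ) (a : ℕ → ℤ) :
    firstMoment (N + 1) a = firstMoment N a + N * a N :=
  Finset.sum_range_succ ..

theorem sum_Ico_one_succ {M : Type*} [AddCommMonoid M] (f : ℕ → M) (n : ℕ) :
    ∑ i ∈ Finset.Ico 1 (n + 1), f i = ∑ i ∈ Finset.range n, f (i + 1) := by
  simp [Finset.sum_Ico_eq_sum_range, add_comm]

theorem sum_suffixSum (N : ℕ) (a : ℕ → ℤ) :
    ∑ j ∈ Finset.Ico 1 N, suffixSum N a j = firstMoment N a := by
  unfold suffixSum firstMoment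
  rw [Finset.sum_comm' (t' := Finset.range N) (s' := fun i => Finset.Ico 1 (i + 1))]
  · exact Finset.sum_congr rfl fun i _ => by simp
  · intro i j
    simp only [Finset.mem_Ico, Finset.mem_range]
    omega

theorem suffixSum_deleteAt (a : ℕ → ℤ) (hd : d ≤ N) (hj : j ≤ N) :
    suffixSum (N + 1) a j = suffixSum N (deleteAt a d) j + a (max j d) := by
  induction hj using Nat.decreasingInduction with
  | self => simp [suffixSum, hd]
  | of_succ j hj ih =>
    rw [suffixSum_eq_add (by omega), suffixSum_eq_add hj, ih]
    rcases lt_or_ge j d with h | h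
    · rw [deleteAt_of_lt a h, max_eq_right h, max_eq_right h.le]
      ring
    · rw [deleteAt_of_le a h, max_eq_left (by omega), max_eq_left h]
      ring

theorem firstMoment_deleteAt (a : ℕ → ℤ) (hd : d ≤ N) :
    firstMoment (N + 1) a =
      firstMoment N (deleteAt a d) + d * a d + suffixSum N (deleteAt a d) d := by
  induction N, hd using Nat.le_induction with
  | base =>
    have h : firstMoment d (deleteAt a d) = firstMoment d a :=
      Finset.sum_congr rfl fun i hi => by rw [deleteAt_of_lt a (Finset.mem_range.1 hi)]
    simp [firstMoment_succ_top, suffixSum, h]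
  | succ N hd ih =>
    rw [firstMoment_succ_top (N + 1), ih, firstMoment_succ_top N (deleteAt a d),
      suffixSum_succ_top hd, deleteAt_of_le a hd]
    push_cast
    ring

/-- The total size of the jumps of `a` that the deletion of its entry at `d` removes. -/
def jumpLoss (a : ℕ → ℤ) (d : ℕ) : ℤ := jump a (d - 1) + jump a d - jump (deleteAt a d) (d - 1)

theorem deleteAt_jump (a : ℕ → ℤ) (hd : 1 ≤ d) :
    deleteAt (jump a) d = jump (deleteAt a d) + Pi.single (d - 1) (jumpLoss a d - jump a d) := by
  funext i
  rw [Pi.add_apply]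
  obtain h | rfl | h : i < d - 1 ∨ i = d - 1 ∨ d ≤ i := by omega
  · rw [Pi.single_eq_of_ne h.ne, deleteAt_of_lt _ (by omega), jump, jump,
      deleteAt_of_lt a (by omega), deleteAt_of_lt a (by omega), add_zero]
  · rw [Pi.single_eq_same, deleteAt_of_lt _ (by omega), jumpLoss]
    ring
  · rw [Pi.single_eq_of_ne (by omega), deleteAt_of_le _ h, jump, jump, deleteAt_of_le a h,
      deleteAt_of_le a (by omega), add_zero]

theorem suffixSum_jump_deleteAt (a : ℕ → ℤ) (hd : 1 ≤ d) (hdN : d ≤ N) (hj : j ≤ N) :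
    suffixSum (N + 1) (jump a) j = suffixSum N (jump (deleteAt a d)) j +
      if j < d then jumpLoss a d else jump a j := by
  rw [suffixSum_deleteAt _ hdN hj, deleteAt_jump a hd, suffixSum_add,
    suffixSum_single (by omega), add_assoc]
  split_ifs with h h'
  · rw [max_eq_right (by omega), sub_add_cancel]
  · omega
  · omega
  · rw [max_eq_left (by omega), zero_add]

theorem firstMoment_jump_deleteAt (a : ℕ → ℤ) (hd : 1 ≤ d) (hdN : d ≤ N) :
    firstMoment (N + 1) (jump a) = firstMoment N (jump (deleteAt a d)) +
      (d - 1) * jumpLoss a d + jump a d + suffixSum N (jump (deleteAt a d)) d := by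
  rw [firstMoment_deleteAt _ hdN, deleteAt_jump a hd, firstMoment_add, suffixSum_add,
    firstMoment_single (by omega), suffixSum_single (by omega), if_neg (by omega)]
  push_cast [Nat.cast_sub hd]
  ring

end Sequences

/-! ### Binary words as integer sequences -/

/-- The entries of `x` at the places `1, …, |x|`, as integers; all other entries are `0`. -/
def toSeq (x : List Bool) (i : ℕ) : ℤ := if (false :: x).getD i false then 1 else 0

/-- All entries of the integer sequence `a` are `0` or `1`. -/
def IsBinary (a : ℕ → ℤ) : Prop := ∀ i, a i = 0 ∨ a i = 1

/-- The integer sequence `A` is binary and vanishes outside the places `1, …, n`. -/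
structure IsWord (n : ℕ) (A : ℕ → ℤ) : Prop where
  isBinary : IsBinary A
  zero : A 0 = 0
  eq_zero_of_lt : ∀ i, n < i → A i = 0

theorem isWord_toSeq (x : List Bool) : IsWord x.length (toSeq x) := by
  refine ⟨fun i => ?_, rfl, fun i hi => ?_⟩
  · unfold toSeq
    split <;> simp
  · rw [toSeq, List.getD_eq_default _ _ (by simpa using hi)]
    rfl

theorem toSeq_succ (x : List Bool) (i : ℕ) :
    toSeq x (i + 1) = if x.getD i false then 1 else 0 := by
  simp [toSeq]

theorem toSeq_succ_eq_toNat (x : List Bool) (i : ℕ) :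
    toSeq x (i + 1) = (x.getD i false).toNat := by
  rw [toSeq_succ]
  cases x.getD i false <;> rfl

theorem toSeq_cons_succ (a : Bool) (x : List Bool) (i : ℕ) :
    toSeq (a :: x) (i + 1 + 1) = toSeq x (i + 1) := by
  simp [toSeq_succ]

theorem getD_eq_of_toSeq_eq {x y : List Bool} {i j : ℕ} (h : toSeq x (i + 1) = toSeq y (j + 1)) :
    x.getD i false = y.getD j false := by
  rw [toSeq_succ, toSeq_succ] at h
  cases hx : x.getD i false <;> cases hy : y.getD j false <;> simp_all

theorem toSeq_injective {x y : List Bool} (hl : x.length = y.length) (h : toSeq x = toSeq y) :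
    x = y := by
  refine List.ext_getElem hl fun i hx hy => ?_
  rw [← List.getD_eq_getElem _ false hx, ← List.getD_eq_getElem _ false hy]
  exact getD_eq_of_toSeq_eq (congrFun h _)

theorem toSeq_eraseIdx (x : List Bool) (k : ℕ) :
    toSeq (x.eraseIdx k) = deleteAt (toSeq x) (k + 1) := by
  funext i
  rcases i with _ | i
  · simp [toSeq, deleteAt]
  · simp only [toSeq_succ, deleteAt, List.getD_eq_getElem?_getD, List.getElem?_eraseIdx,
      Nat.add_lt_add_iff_right]
    split <;> rfl

theorem exists_eraseIdx_of_sublist {x y : List Bool} (h : List.Sublist y x) :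
    y.length + 1 = x.length → ∃ k < x.length, y = x.eraseIdx k := by
  induction h with
  | slnil => simp
  | cons a h _ =>
    intro hl
    exact ⟨0, by simp, by simpa using h.eq_of_length (by simpa using hl)⟩
  | cons_cons a _ ih =>
    intro hl
    obtain ⟨k, hk, rfl⟩ := ih (by simpa using hl)
    exact ⟨k + 1, by simpa using hk, by simp⟩

theorem hamming_cons (a b : Bool) (u v : List Bool) :
    hamming (a :: u) (b :: v) = hamming u v + if a != b then 1 else 0 := by
  simp [hamming, List.countP_cons]

theorem eq_of_hamming_eq_zero {u v : List Bool} (hl : v.length = u.length)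
    (h : hamming u v = 0) : u = v := by
  induction u generalizing v with
  | nil => exact (List.length_eq_zero_iff.1 hl).symm
  | cons a u ih =>
    obtain ⟨b, v, rfl⟩ := List.exists_cons_of_length_eq_add_one hl
    rw [hamming_cons, Nat.add_eq_zero_iff] at h
    rw [ih (by simpa using hl) h.1, show a = b by simpa using h.2]

theorem exists_toSeq_eq_off_of_hamming_le_one {u v : List Bool} (hl : v.length = u.length)
    (h : hamming u v ≤ 1) : ∃ e, ∀ i, i ≠ e → toSeq v i = toSeq u i := by
  induction u generalizing v with
  | nil => exact ⟨0, fun i _ => by rw [List.length_eq_zero_iff.1 hl]⟩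
  | cons a u ih =>
    obtain ⟨b, v, rfl⟩ := List.exists_cons_of_length_eq_add_one hl
    replace hl : v.length = u.length := by simpa using hl
    rw [hamming_cons] at h
    by_cases hab : a = b
    · subst hab
      obtain ⟨e, he⟩ := ih hl (by omega)
      refine ⟨e + 1, fun i hi => ?_⟩
      obtain _ | _ | i := i
      · rfl
      · simp [toSeq_succ]
      · rw [toSeq_cons_succ, toSeq_cons_succ, he _ (by omega)]
    · have h0 : hamming u v = 0 := by simpa [hab] using h
      obtain rfl := eq_of_hamming_eq_zero hl h0
      refine ⟨1, fun i hi => ?_⟩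
      obtain _ | _ | i := i
      · rfl
      · exact absurd rfl hi
      · rw [toSeq_cons_succ, toSeq_cons_succ]

theorem exists_deleteAt_of_mem_ball {x z : List Bool} (h : z ∈ ball x) :
    z.length + 1 = x.length ∧ ∃ d, 1 ≤ d ∧ d ≤ x.length ∧
      ∃ e, ∀ i, i ≠ e → toSeq z i = deleteAt (toSeq x) d i := by
  obtain ⟨w, ⟨hw, hs⟩, hz, hh⟩ := h
  obtain ⟨k, hk, rfl⟩ := exists_eraseIdx_of_sublist hs hw
  obtain ⟨e, he⟩ := exists_toSeq_eq_off_of_hamming_le_one hz hh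
  refine ⟨by omega, k + 1, by omega, by omega, e, fun i hi => ?_⟩
  rw [← toSeq_eraseIdx, he i hi]

theorem length_diffSeq (x : List Bool) : (diffSeq x).length = x.length + 1 := by
  simp [diffSeq]

theorem getD_diffSeq (x : List Bool) (i : ℕ) :
    (diffSeq x).getD i false = Bool.xor (x.getD i false) ((false :: x).getD i false) := by
  by_cases hi : i < x.length + 1
  · have h : (x ++ [false]).getD i false = x.getD i false := by
      rcases (Nat.lt_succ_iff.1 hi).lt_or_eq with hi | rfl
      · exact List.getD_append _ _ _ _ hi
      · simp
    rw [← h, List.getD_eq_getElem _ _ (by rwa [length_diffSeq]),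
      List.getD_eq_getElem _ _ (by simpa using hi), List.getD_eq_getElem _ _ (by simpa using hi)]
    simp [diffSeq]
  · rw [List.getD_eq_default _ _ (by rw [length_diffSeq]; omega),
      List.getD_eq_default _ _ (by omega), List.getD_eq_default _ _ (by simpa using hi)]
    rfl

theorem toSeq_diffSeq (x : List Bool) (i : ℕ) : toSeq (diffSeq x) (i + 1) = jump (toSeq x) i := by
  rw [toSeq_succ, getD_diffSeq, jump, toSeq_succ, toSeq]
  cases x.getD i false <;> cases (false :: x).getD i false <;> simp

theorem wt_eq_sum (x : List Bool) :
    (wt x : ℤ) = ∑ i ∈ Finset.range x.length, toSeq x (i + 1) := by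
  induction x with
  | nil => rfl
  | cons a x ih =>
    rw [List.length_cons, Finset.sum_range_succ',
      Finset.sum_congr rfl fun i _ => toSeq_cons_succ a x i, ← ih, toSeq_succ]
    cases a <;> simp [wt]

theorem wt_take_drop (x : List Bool) {a m : ℕ} (h : a + m ≤ x.length) :
    (wt ((x.drop a).take m) : ℤ) = ∑ i ∈ Finset.Ico (a + 1) (a + m + 1), toSeq x i := by
  have hl : ((x.drop a).take m).length = m := by
    rw [List.length_take, List.length_drop]
    omega
  rw [wt_eq_sum, hl, Finset.sum_Ico_eq_sum_range, show a + m + 1 - (a + 1) = m by omega]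
  refine Finset.sum_congr rfl fun i hi => ?_
  rw [add_right_comm, toSeq_succ, toSeq_succ]
  simp [List.getD_eq_getElem?_getD, Finset.mem_range.1 hi]

theorem VT_zero_eq (x : List Bool) :
    (VT 0 x : ℤ) = suffixSum (x.length + 1) (toSeq x) 0 := by
  rw [VT, wt_eq_sum, suffixSum, ← Finset.range_eq_Ico, Finset.sum_range_succ',
    (isWord_toSeq x).zero, add_zero]

theorem VT_succ_eq (k : ℕ) (x : List Bool) :
    (VT (k + 1) x : ℤ) =
      ∑ j ∈ Finset.Ico 1 (x.length + 1), (j : ℤ) ^ k * suffixSum (x.length + 1) (toSeq x) j := by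
  simp only [VT, suffixSum, Nat.cast_sum, Nat.cast_mul, Nat.cast_pow, ← toSeq_succ_eq_toNat,
    Finset.mul_sum]
  rw [← sum_Ico_one_succ (fun i => ∑ j ∈ Finset.Icc 1 i, (j : ℤ) ^ k * toSeq x i)]
  apply Finset.sum_comm'
  intro i j
  simp only [Finset.mem_Ico, Finset.mem_Icc]
  omega

theorem VT_one_eq (x : List Bool) : (VT 1 x : ℤ) = firstMoment (x.length + 1) (toSeq x) := by
  simp only [VT_succ_eq, pow_zero, one_mul, sum_suffixSum]

theorem VT_zero_diffSeq (x : List Bool) :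
    (VT 0 (diffSeq x) : ℤ) = suffixSum (x.length + 1) (jump (toSeq x)) 0 := by
  simp only [VT, wt_eq_sum, suffixSum, ← Finset.range_eq_Ico, length_diffSeq, toSeq_diffSeq]

theorem VT_one_diffSeq (x : List Bool) :
    (VT 1 (diffSeq x) : ℤ) = firstMoment (x.length + 1) (jump (toSeq x)) +
      suffixSum (x.length + 1) (jump (toSeq x)) 0 := by
  simp only [VT_one_eq, length_diffSeq, firstMoment, suffixSum, ← Finset.range_eq_Ico]
  rw [Finset.sum_range_succ', ← Finset.sum_add_distrib]
  simp only [toSeq_diffSeq, Nat.cast_zero, zero_mul, add_zero, Nat.cast_add, Nat.cast_one, add_mul,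
    one_mul]

section Binary

variable {a b : ℕ → ℤ}

theorem IsBinary.deleteAt (ha : IsBinary a) (d : ℕ) : IsBinary (deleteAt a d) := fun i => by
  unfold DelSub.deleteAt
  split
  exacts [ha _, ha _]

theorem IsBinary.jump (ha : IsBinary a) : IsBinary (jump a) := fun i => by
  unfold DelSub.jump
  rcases ha i with h | h <;> rcases ha (i + 1) with h' | h' <;> rw [h, h'] <;> simp

theorem IsBinary.jumpLoss (ha : IsBinary a) {d : ℕ} (hd : 1 ≤ d) :
    jumpLoss a d = 0 ∨ jumpLoss a d = 2 := by
  obtain ⟨d, rfl⟩ := Nat.exists_eq_add_of_le' hd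
  rw [DelSub.jumpLoss, Nat.add_sub_cancel, DelSub.jump, DelSub.jump, DelSub.jump,
    deleteAt_of_lt a d.lt_succ_self, deleteAt_of_le a le_rfl]
  rcases ha d with h | h <;> rcases ha (d + 1) with h' | h' <;>
    rcases ha (d + 1 + 1) with h'' | h'' <;> rw [h, h', h''] <;> simp

-- Both jumps next to an altered entry change by one, in the same or in opposite directions.
theorem IsBinary.exists_jump_sub_eq (ha : IsBinary a) (hb : IsBinary b) {k : ℕ} {σ : ℤ}
    (h : a - b = Pi.single (k + 1) σ) :
    ∃ s u : ℤ, (s = 0 ∨ s = 2 ∨ s = -2) ∧ (σ = 0 → s = 0) ∧ |u| ≤ 1 ∧ |s - u| ≤ 1 ∧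
      DelSub.jump a - DelSub.jump b = Pi.single k u + Pi.single (k + 1) (s - u) := by
  have hoff {i : ℕ} (hi : i ≠ k + 1) : a i = b i := by
    have := congrFun h i
    rwa [Pi.sub_apply, Pi.single_eq_of_ne hi, sub_eq_zero] at this
  have hat : a (k + 1) - b (k + 1) = σ := by
    rw [← Pi.sub_apply, h, Pi.single_eq_same]
  refine ⟨(DelSub.jump a - DelSub.jump b) k + (DelSub.jump a - DelSub.jump b) (k + 1),
    (DelSub.jump a - DelSub.jump b) k, ?_⟩
  rw [add_sub_cancel_left, ← and_assoc, ← and_assoc, ← and_assoc]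
  refine ⟨?_, ?_⟩
  · simp only [Pi.sub_apply, DelSub.jump, hoff k.lt_succ_self.ne,
      hoff (k + 1).lt_succ_self.ne', ← hat]
    rcases hb k with h1 | h1 <;> rcases hb (k + 1) with h2 | h2 <;>
      rcases ha (k + 1) with h3 | h3 <;> rcases hb (k + 1 + 1) with h4 | h4 <;>
      rw [h1, h2, h3, h4] <;> simp
  · funext i
    rw [Pi.add_apply]
    by_cases h1 : i = k
    · rw [h1, Pi.single_eq_same, Pi.single_eq_of_ne k.lt_succ_self.ne, add_zero]
    by_cases h2 : i = k + 1
    · rw [h2, Pi.single_eq_same, Pi.single_eq_of_ne k.lt_succ_self.ne', zero_add]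
    · rw [Pi.single_eq_of_ne h1, Pi.single_eq_of_ne h2, Pi.sub_apply, DelSub.jump, DelSub.jump,
        hoff h2, hoff (by omega), sub_self, add_zero]

end Binary

/-! ### Alignments -/

/-- `A` without its entry at `d` and `B` without its entry at `d'` agree except perhaps at the
places `e < f`, where they differ by `σ` and by `τ`. A common word in the balls of two words of
length `n` gives such an alignment. -/
structure Alignment (n : ℕ) (A B : ℕ → ℤ) (d d' e f : ℕ) (σ τ : ℤ) : Prop where
  one_le_left : 1 ≤ d
  left_le : d ≤ n
  one_le_right : 1 ≤ d'
  right_le : d' ≤ n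
  one_le_fst : 1 ≤ e
  fst_lt_snd : e < f
  snd_lt : f < n
  fst_trit : σ = 0 ∨ σ = 1 ∨ σ = -1
  snd_trit : τ = 0 ∨ τ = 1 ∨ τ = -1
  sub_eq : deleteAt A d - deleteAt B d' = Pi.single e σ + Pi.single f τ

theorem exists_eq_single_add_single {n e f : ℕ} (hn : 3 ≤ n) {g : ℕ → ℤ}
    (hg : ∀ i, g i ≠ 0 → (1 ≤ i ∧ i < n) ∧ (i = e ∨ i = f)) :
    ∃ e f : ℕ, 1 ≤ e ∧ e < f ∧ f < n ∧ g = Pi.single e (g e) + Pi.single f (g f) := by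
  obtain ⟨s, hs, hsn, hcard⟩ := Finset.exists_subsuperset_card_eq (n := 2)
    (s := ({e, f} : Finset ℕ) ∩ Finset.Ico 1 n) (t := Finset.Ico 1 n) Finset.inter_subset_right
    ((Finset.card_le_card Finset.inter_subset_left).trans Finset.card_le_two)
    (by rw [Nat.card_Ico]; omega)
  obtain ⟨p, q, hpq, rfl⟩ := Finset.card_eq_two.1 hcard
  have hp := Finset.mem_Ico.1 (hsn (Finset.mem_insert_self p _))
  have hq := Finset.mem_Ico.1 (hsn (Finset.mem_insert_of_mem (Finset.mem_singleton_self q)))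
  have hgs {i : ℕ} (hi : g i ≠ 0) : i = p ∨ i = q := by
    have := hs (Finset.mem_inter.2 ⟨by simpa using (hg i hi).2, Finset.mem_Ico.2 (hg i hi).1⟩)
    simpa using this
  have hsum : g = Pi.single p (g p) + Pi.single q (g q) := by
    funext i
    rw [Pi.add_apply]
    by_cases h1 : i = p
    · rw [h1, Pi.single_eq_same, Pi.single_eq_of_ne hpq, add_zero]
    by_cases h2 : i = q
    · rw [h2, Pi.single_eq_same, Pi.single_eq_of_ne hpq.symm, zero_add]
    · rw [Pi.single_eq_of_ne h1, Pi.single_eq_of_ne h2, add_zero]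
      by_contra hi
      exact (hgs hi).elim h1 h2
  rcases hpq.lt_or_gt with h | h
  · exact ⟨p, q, hp.1, h, hq.2, hsum⟩
  · exact ⟨q, p, hq.1, h, hp.2, by rw [add_comm]; exact hsum⟩

theorem exists_alignment {n : ℕ} (hn : 3 ≤ n) {A B Z : ℕ → ℤ} (hA : IsWord n A) (hB : IsWord n B)
    {d d' e f : ℕ} (hd : 1 ≤ d) (hdn : d ≤ n) (hd' : 1 ≤ d') (hdn' : d' ≤ n)
    (he : ∀ i, i ≠ e → Z i = deleteAt A d i) (hf : ∀ i, i ≠ f → Z i = deleteAt B d' i) :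
    ∃ e f σ τ, Alignment n A B d d' e f σ τ := by
  have htrit (i : ℕ) : (deleteAt A d - deleteAt B d') i = 0 ∨
      (deleteAt A d - deleteAt B d') i = 1 ∨ (deleteAt A d - deleteAt B d') i = -1 := by
    rw [Pi.sub_apply]
    rcases hA.isBinary.deleteAt d i with h | h <;>
      rcases hB.isBinary.deleteAt d' i with h' | h' <;> rw [h, h'] <;> simp
  obtain ⟨p, q, hp, hpq, hq, hsub⟩ := exists_eq_single_add_single (e := e) (f := f) hn
    (g := deleteAt A d - deleteAt B d') fun i hi => by
      rw [Pi.sub_apply, sub_ne_zero] at hi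
      refine ⟨⟨?_, ?_⟩, ?_⟩ <;> by_contra hc
      · obtain rfl : i = 0 := by omega
        exact hi (by rw [deleteAt_of_lt A hd, deleteAt_of_lt B hd', hA.zero, hB.zero])
      · exact hi (by rw [deleteAt_of_le A (by omega), deleteAt_of_le B (by omega),
          hA.eq_zero_of_lt _ (by omega), hB.eq_zero_of_lt _ (by omega)])
      · rw [not_or] at hc
        exact hi (by rw [← he i hc.1, hf i hc.2])
  exact ⟨p, q, _, _, hd, hdn, hd', hdn', hp, hpq, hq, htrit p, htrit q, hsub⟩

namespace Alignment

variable {n : ℕ} {A B : ℕ → ℤ} {d d' e f : ℕ} {σ τ : ℤ}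

theorem symm (h : Alignment n A B d d' e f σ τ) : Alignment n B A d' d e f (-σ) (-τ) where
  one_le_left := h.one_le_right
  left_le := h.right_le
  one_le_right := h.one_le_left
  right_le := h.left_le
  one_le_fst := h.one_le_fst
  fst_lt_snd := h.fst_lt_snd
  snd_lt := h.snd_lt
  fst_trit := by have := h.fst_trit; omega
  snd_trit := by have := h.snd_trit; omega
  sub_eq := by
    rw [← neg_sub, h.sub_eq, neg_add, Pi.single_neg, Pi.single_neg]

theorem deleteAt_sub_apply (h : Alignment n A B d d' e f σ τ) (i : ℕ) :
    deleteAt A d i - deleteAt B d' i = (if i = e then σ else 0) + if i = f then τ else 0 := by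
  rw [← Pi.sub_apply, h.sub_eq, Pi.add_apply, Pi.single_apply, Pi.single_apply]

theorem suffixSum_deleteAt_sub (h : Alignment n A B d d' e f σ τ) (j : ℕ) :
    suffixSum n (deleteAt A d) j - suffixSum n (deleteAt B d') j =
      (if j ≤ e then σ else 0) + if j ≤ f then τ else 0 := by
  rw [← suffixSum_sub, h.sub_eq, suffixSum_add, suffixSum_single (h.fst_lt_snd.trans h.snd_lt),
    suffixSum_single h.snd_lt]

theorem firstMoment_deleteAt_sub (h : Alignment n A B d d' e f σ τ) :
    firstMoment n (deleteAt A d) - firstMoment n (deleteAt B d') = e * σ + f * τ := by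
  rw [← firstMoment_sub, h.sub_eq, firstMoment_add,
    firstMoment_single (h.fst_lt_snd.trans h.snd_lt), firstMoment_single h.snd_lt]

theorem suffixSum_sub (h : Alignment n A B d d' e f σ τ) {j : ℕ} (hj : j ≤ n) :
    suffixSum (n + 1) A j - suffixSum (n + 1) B j =
      (if j ≤ e then σ else 0) + (if j ≤ f then τ else 0) + (A (max j d) - B (max j d')) := by
  rw [suffixSum_deleteAt A h.left_le hj, suffixSum_deleteAt B h.right_le hj,
    ← h.suffixSum_deleteAt_sub j]
  ring

theorem abs_suffixSum_sub_le (h : Alignment n A B d d' e f σ τ) (hA : IsBinary A)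
    (hB : IsBinary B) {j : ℕ} (hj : j ≤ n) :
    |suffixSum (n + 1) A j - suffixSum (n + 1) B j| ≤ 3 := by
  rw [h.suffixSum_sub hj, abs_le]
  have := h.fst_trit
  have := h.snd_trit
  have := hA (max j d)
  have := hB (max j d')
  split_ifs <;> omega

theorem add_eq_of_suffixSum_eq (h : Alignment n A B d d' e f σ τ)
    (hw : suffixSum (n + 1) A 0 = suffixSum (n + 1) B 0) : σ + τ + A d = B d' := by
  have := h.suffixSum_sub n.zero_le
  simp only [Nat.zero_le, if_true, zero_max] at this
  linarith

theorem abs_moment_le (h : Alignment n A B d d' e f σ τ) (hdd : d ≤ d')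
    (hm : firstMoment (n + 1) A = firstMoment (n + 1) B) :
    |e * σ + f * τ + d * A d - d' * B d' + ∑ i ∈ Finset.Ico d d', B i| ≤ 2 := by
  have hB : suffixSum n (deleteAt B d') d =
      ∑ i ∈ Finset.Ico d d', B i + suffixSum n (deleteAt B d') d' := by
    rw [suffixSum_eq_sum_Ico_add hdd h.right_le]
    exact congrArg (· + _) (Finset.sum_congr rfl fun i hi =>
      deleteAt_of_lt B (Finset.mem_Ico.1 hi).2)
  have hsum : e * σ + f * τ + d * A d - d' * B d' + ∑ i ∈ Finset.Ico d d', B i =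
      -((if d ≤ e then σ else 0) + if d ≤ f then τ else 0) := by
    rw [firstMoment_deleteAt A h.left_le, firstMoment_deleteAt B h.right_le] at hm
    linarith [h.firstMoment_deleteAt_sub, h.suffixSum_deleteAt_sub d]
  rw [hsum, abs_le]
  have := h.fst_trit
  have := h.snd_trit
  split_ifs <;> omega

theorem isBinary_add_single (h : Alignment n A B d d' e f σ τ) (hA : IsBinary A)
    (hB : IsBinary B) : IsBinary (deleteAt B d' + Pi.single e σ) := fun i => by
  have hi := h.deleteAt_sub_apply i
  have hef := h.fst_lt_snd
  rw [Pi.add_apply, Pi.single_apply]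
  by_cases hie : i = e
  · rw [if_pos hie, if_neg (by omega)] at hi
    rw [if_pos hie, show deleteAt B d' i + σ = deleteAt A d i by linarith]
    exact hA.deleteAt d i
  · rw [if_neg hie, add_zero]
    exact hB.deleteAt d' i

theorem exists_jump_deleteAt_sub_eq (h : Alignment n A B d d' (e + 1) (f + 1) σ τ)
    (hA : IsBinary A) (hB : IsBinary B) :
    ∃ s s' u u' : ℤ, (s = 0 ∨ s = 2 ∨ s = -2) ∧ (s' = 0 ∨ s' = 2 ∨ s' = -2) ∧ (σ = 0 → s = 0) ∧
      (τ = 0 → s' = 0) ∧ (|u| ≤ 1 ∧ |s - u| ≤ 1) ∧ (|u'| ≤ 1 ∧ |s' - u'| ≤ 1) ∧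
      jump (deleteAt A d) - jump (deleteAt B d') = Pi.single e u + Pi.single (e + 1) (s - u) +
        (Pi.single f u' + Pi.single (f + 1) (s' - u')) := by
  have hG := h.isBinary_add_single hA hB
  obtain ⟨s, u, hs, hs0, hu, hsu, hjG⟩ := hG.exists_jump_sub_eq (hB.deleteAt d') (σ := σ)
    (add_sub_cancel_left _ _)
  obtain ⟨s', u', hs', hs0', hu', hsu', hjA⟩ := (hA.deleteAt d).exists_jump_sub_eq hG (k := f)
    (σ := τ) (by rw [← sub_sub, h.sub_eq, add_sub_cancel_left])
  refine ⟨s, s', u, u', hs, hs', hs0, hs0', ⟨hu, hsu⟩, ⟨hu', hsu'⟩, ?_⟩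
  rw [← hjA, ← hjG]
  abel

theorem exists_moments_jump_deleteAt_sub (h : Alignment n A B d d' e f σ τ) (hA : IsBinary A)
    (hB : IsBinary B) :
    ∃ s s' : ℤ, (s = 0 ∨ s = 2 ∨ s = -2) ∧ (s' = 0 ∨ s' = 2 ∨ s' = -2) ∧ (σ = 0 → s = 0) ∧
      (τ = 0 → s' = 0) ∧
      |firstMoment n (jump (deleteAt A d)) - firstMoment n (jump (deleteAt B d')) -
        (e * s + f * s')| ≤ 2 ∧
      (∀ j, |suffixSum n (jump (deleteAt A d)) j - suffixSum n (jump (deleteAt B d')) j| ≤ 4) ∧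
      suffixSum n (jump (deleteAt A d)) 0 - suffixSum n (jump (deleteAt B d')) 0 = s + s' := by
  obtain ⟨e, rfl⟩ := Nat.exists_eq_add_of_le' h.one_le_fst
  obtain ⟨f, rfl⟩ := Nat.exists_eq_add_of_le' (h.one_le_fst.trans h.fst_lt_snd.le)
  have hef := h.fst_lt_snd
  have hfn := h.snd_lt
  obtain ⟨s, s', u, u', hs, hs', hs0, hs0', ⟨hu, hsu⟩, ⟨hu', hsu'⟩, hj⟩ :=
    h.exists_jump_deleteAt_sub_eq hA hB
  have hsuf (j : ℕ) :
      suffixSum n (jump (deleteAt A d)) j - suffixSum n (jump (deleteAt B d')) j =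
        (if j ≤ e then u else 0) + (if j ≤ e + 1 then s - u else 0) +
          ((if j ≤ f then u' else 0) + if j ≤ f + 1 then s' - u' else 0) := by
    rw [← DelSub.suffixSum_sub, hj, suffixSum_add, suffixSum_add, suffixSum_add]
    rw [suffixSum_single (by omega), suffixSum_single (by omega), suffixSum_single (by omega),
      suffixSum_single (by omega)]
  rw [abs_le] at hu hsu hu' hsu'
  refine ⟨s, s', hs, hs', hs0, hs0', ?_, fun j => ?_, ?_⟩
  · rw [← firstMoment_sub, hj, firstMoment_add, firstMoment_add, firstMoment_add,
      firstMoment_single (by omega), firstMoment_single (by omega),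
      firstMoment_single (by omega), firstMoment_single (by omega), abs_le]
    push_cast
    constructor <;> linarith
  · rw [hsuf, abs_le]
    split_ifs <;> omega
  · rw [hsuf]
    simp

theorem abs_suffixSum_jump_sub_le (h : Alignment n A B d d' e f σ τ) (hA : IsBinary A)
    (hB : IsBinary B) {j : ℕ} (hj : j ≤ n) :
    |suffixSum (n + 1) (jump A) j - suffixSum (n + 1) (jump B) j| ≤ 6 := by
  obtain ⟨-, -, -, -, -, -, -, hD, -⟩ := h.exists_moments_jump_deleteAt_sub hA hB
  rw [suffixSum_jump_deleteAt A h.one_le_left h.left_le hj,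
    suffixSum_jump_deleteAt B h.one_le_right h.right_le hj, abs_le]
  have := abs_le.1 (hD j)
  have := hA.jumpLoss h.one_le_left
  have := hB.jumpLoss h.one_le_right
  have := hA.jump j
  have := hB.jump j
  split_ifs <;> omega

theorem abs_sum_jump_deleteAt_sub_le (hB : IsBinary B) (hdd : d ≤ d') :
    |∑ i ∈ Finset.Ico d d', jump (deleteAt B d') i - ∑ i ∈ Finset.Ico d d', jump B i| ≤ 1 := by
  rcases hdd.eq_or_lt with rfl | hdd
  · simp
  obtain ⟨c, rfl⟩ := Nat.exists_eq_add_of_le' (Nat.one_le_of_lt hdd)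
  have hlow : ∑ i ∈ Finset.Ico d c, jump (deleteAt B (c + 1)) i =
      ∑ i ∈ Finset.Ico d c, jump B i :=
    Finset.sum_congr rfl fun i hi => by
      have := (Finset.mem_Ico.1 hi).2
      rw [jump, jump, deleteAt_of_lt B (by omega), deleteAt_of_lt B (by omega)]
  rw [Finset.sum_Ico_succ_top (by omega), Finset.sum_Ico_succ_top (by omega), hlow,
    add_sub_add_left_eq_sub, abs_le]
  have := hB.jump c
  have := (hB.deleteAt (c + 1)).jump c
  omega

theorem exists_jump_moment (h : Alignment n A B d d' e f σ τ) (hA : IsBinary A)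
    (hB : IsBinary B) (hdd : d ≤ d')
    (hw : suffixSum (n + 1) (jump A) 0 = suffixSum (n + 1) (jump B) 0)
    (hm : firstMoment (n + 1) (jump A) = firstMoment (n + 1) (jump B)) :
    ∃ s s' α β : ℤ, (s = 0 ∨ s = 2 ∨ s = -2) ∧ (s' = 0 ∨ s' = 2 ∨ s' = -2) ∧ (σ = 0 → s = 0) ∧
      (τ = 0 → s' = 0) ∧ (α = 0 ∨ α = 2) ∧ (β = 0 ∨ β = 2) ∧ s + s' + α = β ∧
      |e * s + f * s' + d * α - d' * β + ∑ i ∈ Finset.Ico d d', jump B i| ≤ 10 := by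
  obtain ⟨s, s', hs, hs', hs0, hs0', hmom, hsuf, hsum⟩ :=
    h.exists_moments_jump_deleteAt_sub hA hB
  have hα := hA.jumpLoss h.one_le_left
  have hβ := hB.jumpLoss h.one_le_right
  have hbal : s + s' + jumpLoss A d = jumpLoss B d' := by
    have hA0 := suffixSum_jump_deleteAt A h.one_le_left h.left_le n.zero_le
    have hB0 := suffixSum_jump_deleteAt B h.one_le_right h.right_le n.zero_le
    rw [if_pos (Nat.succ_le_iff.1 h.one_le_left)] at hA0
    rw [if_pos (Nat.succ_le_iff.1 h.one_le_right)] at hB0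
    linarith
  refine ⟨s, s', _, _, hs, hs', hs0, hs0', hα, hβ, hbal, ?_⟩
  rw [firstMoment_jump_deleteAt A h.one_le_left h.left_le,
    firstMoment_jump_deleteAt B h.one_le_right h.right_le] at hm
  have hsplit := suffixSum_eq_sum_Ico_add hdd h.right_le (jump (deleteAt B d'))
  have hD := abs_le.1 (hsuf d)
  have hcut := abs_le.1 (abs_sum_jump_deleteAt_sub_le hB hdd)
  have hloss : |jumpLoss B d' - jumpLoss A d| ≤ 2 := by
    rw [abs_le]
    omega
  have hjump : |jump A d - jump B d'| ≤ 1 := by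
    have := hA.jump d
    have := hB.jump d'
    rw [abs_le]
    omega
  rw [abs_le] at hmom hloss hjump ⊢
  constructor <;> linarith

end Alignment

/-! ### Sequences that differ in a short window -/

-- The quadratic with roots `a + 1/2` and `b + 1/2` has the same sign pattern as `D`.
theorem eq_zero_of_moments_eq_zero {S : Finset ℕ} {D : ℕ → ℤ} {a b : ℤ} (hab : a ≤ b)
    (hout : ∀ j ∈ S, (j ≤ a ∨ b < j) → 0 ≤ D j) (hin : ∀ j ∈ S, a < j → j ≤ b → D j ≤ 0)
    (hmom : ∀ k < 3, ∑ j ∈ S, (j : ℤ) ^ k * D j = 0) : ∀ j ∈ S, D j = 0 := by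
  set p : ℕ → ℤ := fun j => (2 * j - 2 * a - 1) * (2 * j - 2 * b - 1) with hp
  have hsum : ∑ j ∈ S, p j * D j = 0 := by
    have hexpand (j : ℕ) : p j * D j = (2 * a + 1) * (2 * b + 1) * ((j : ℤ) ^ 0 * D j) +
        -4 * (a + b + 1) * ((j : ℤ) ^ 1 * D j) + 4 * ((j : ℤ) ^ 2 * D j) := by
      rw [hp]
      ring
    simp only [hexpand, Finset.sum_add_distrib, ← Finset.mul_sum]
    rw [hmom 0 (by norm_num), hmom 1 (by norm_num), hmom 2 (by norm_num)]
    ring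
  have hnonneg : ∀ j ∈ S, 0 ≤ p j * D j := by
    intro j hj
    by_cases hc : (j : ℤ) ≤ a ∨ b < j
    · refine mul_nonneg ?_ (hout j hj hc)
      rcases hc with hc | hc
      · exact mul_nonneg_of_nonpos_of_nonpos (by omega) (by omega)
      · exact mul_nonneg (by omega) (by omega)
    · exact mul_nonneg_of_nonpos_of_nonpos (mul_nonpos_of_nonneg_of_nonpos (by omega) (by omega))
        (hin j hj (by omega) (by omega))
  intro j hj
  exact (mul_eq_zero.1 ((Finset.sum_eq_zero_iff_of_nonneg hnonneg).1 hsum j hj)).resolve_left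
    (mul_ne_zero (by omega) (by omega))

theorem sum_pow_mul_eq_zero_of_dvd {m M k : ℕ} {C : ℤ} {D : ℕ → ℤ} (hC : 0 < C) (hmM : m ≤ M)
    (hD1 : D 1 = 0) (hD : ∀ j ∈ Finset.Ico 1 (m + 1), |D j| ≤ C)
    (hdvd : C * (M : ℤ) ^ (k + 1) ∣ ∑ j ∈ Finset.Ico 1 (m + 1), (j : ℤ) ^ k * D j) :
    ∑ j ∈ Finset.Ico 1 (m + 1), (j : ℤ) ^ k * D j = 0 := by
  obtain _ | m := m
  · simp
  refine Int.eq_zero_of_abs_lt_dvd hdvd ?_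
  have hMk : 0 < (M : ℤ) ^ k := pow_pos (by omega) k
  rw [Finset.sum_eq_sum_Ico_succ_bot (by omega), hD1, mul_zero, zero_add]
  calc |∑ j ∈ Finset.Ico (1 + 1) (m + 1 + 1), (j : ℤ) ^ k * D j|
      ≤ ∑ j ∈ Finset.Ico (1 + 1) (m + 1 + 1), |(j : ℤ) ^ k * D j| :=
        Finset.abs_sum_le_sum_abs _ _
    _ ≤ ∑ _j ∈ Finset.Ico (1 + 1) (m + 1 + 1), (M : ℤ) ^ k * C := by
        refine Finset.sum_le_sum fun j hj => ?_
        rw [Finset.mem_Ico] at hj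
        rw [abs_mul, abs_of_nonneg (by positivity)]
        have := hD j (Finset.mem_Ico.2 ⟨by omega, hj.2⟩)
        gcongr
        omega
    _ = m * ((M : ℤ) ^ k * C) := by
        rw [Finset.sum_const, Nat.card_Ico, nsmul_eq_mul]
        congr 2
    _ < M * ((M : ℤ) ^ k * C) := by
        have : (m : ℤ) < M := by omega
        gcongr
    _ = C * (M : ℤ) ^ (k + 1) := by ring

theorem exists_sign_interval {p q d : ℕ} {σ τ u : ℤ} (hpq : p < q)
    (hσ : σ = 0 ∨ σ = 1 ∨ σ = -1) (hτ : τ = 0 ∨ τ = 1 ∨ τ = -1) (hu : u = 0 ∨ u = 1)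
    (hsum : σ + τ + u = 0) :
    ∃ a b : ℕ, a ≤ b ∧ ∀ (j : ℕ) (v : ℤ), (v = 0 ∨ v = 1) →
      ((j ≤ a ∨ b < j) → 0 ≤ (if j ≤ p then σ else 0) + (if j ≤ q then τ else 0) +
        if j ≤ d then u else v) ∧
      (a < j → j ≤ b → (if j ≤ p then σ else 0) + (if j ≤ q then τ else 0) +
        (if j ≤ d then u else v) ≤ 0) := by
  obtain ⟨rfl, rfl, rfl⟩ | ⟨rfl, rfl, rfl⟩ | ⟨rfl, rfl, rfl⟩ | ⟨rfl, rfl, rfl⟩ | ⟨rfl, rfl, rfl⟩ :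
      (σ = 0 ∧ τ = 0 ∧ u = 0) ∨ (σ = -1 ∧ τ = 1 ∧ u = 0) ∨ (σ = 1 ∧ τ = -1 ∧ u = 0) ∨
        (σ = -1 ∧ τ = 0 ∧ u = 1) ∨ (σ = 0 ∧ τ = -1 ∧ u = 1) := by omega
  · exact ⟨0, 0, le_rfl, fun j v hv => ⟨fun _ => by split_ifs <;> omega, by omega⟩⟩
  · exact ⟨0, 0, le_rfl, fun j v hv => ⟨fun _ => by split_ifs <;> omega, by omega⟩⟩
  · exact ⟨p, q, hpq.le, fun j v hv =>
      ⟨fun _ => by split_ifs <;> omega, fun _ _ => by split_ifs <;> omega⟩⟩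
  · exact ⟨d, max d p, le_max_left _ _, fun j v hv =>
      ⟨fun _ => by split_ifs <;> omega, fun _ _ => by split_ifs <;> omega⟩⟩
  · exact ⟨d, max d q, le_max_left _ _, fun j v hv =>
      ⟨fun _ => by split_ifs <;> omega, fun _ _ => by split_ifs <;> omega⟩⟩

namespace Alignment

variable {n : ℕ} {A B : ℕ → ℤ} {d d' e f : ℕ} {σ τ : ℤ}

theorem suffixSum_sub_eq (h : Alignment n A B d d' e f σ τ) (hdd : d ≤ d') {j : ℕ} (hj : j ≤ n) :
    suffixSum (n + 1) A j - suffixSum (n + 1) B j =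
      (if j ≤ (if e < d then e else e + 1) then σ else 0) +
      (if j ≤ (if f < d then f else f + 1) then τ else 0) +
      if j ≤ d then A d - B d' else (if j ≤ d' then B (j - 1) else B d') - B d' := by
  rw [h.suffixSum_sub hj]
  rcases le_or_gt j d with hjd | hjd
  · rw [max_eq_right hjd, max_eq_right (hjd.trans hdd), if_pos hjd]
    split_ifs <;> omega
  · have hd := h.deleteAt_sub_apply (j - 1)
    rw [deleteAt_of_le A (by omega), Nat.sub_add_cancel (by omega)] at hd
    rw [max_eq_left hjd.le, if_neg hjd.not_ge]
    rcases le_or_gt j d' with hjd' | hjd'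
    · rw [deleteAt_of_lt B (by omega)] at hd
      rw [max_eq_right hjd', if_pos hjd']
      split_ifs at hd ⊢ <;> omega
    · rw [deleteAt_of_le B (by omega), Nat.sub_add_cancel (by omega)] at hd
      rw [max_eq_left hjd'.le, if_neg hjd'.not_ge]
      split_ifs at hd ⊢ <;> omega

theorem exists_signs (h : Alignment n A B d d' e f σ τ) (hA : IsBinary A) (hB : IsBinary B)
    (hw : suffixSum (n + 1) A 0 = suffixSum (n + 1) B 0) :
    ∃ a b : ℕ, ∃ ε : ℤ, a ≤ b ∧ ε ≠ 0 ∧ ∀ j ≤ n,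
      ((j ≤ a ∨ b < j) → 0 ≤ ε * (suffixSum (n + 1) A j - suffixSum (n + 1) B j)) ∧
      (a < j → j ≤ b → ε * (suffixSum (n + 1) A j - suffixSum (n + 1) B j) ≤ 0) := by
  wlog hdd : d ≤ d' generalizing A B d d' σ τ
  · obtain ⟨a, b, ε, hab, hε, hsign⟩ := this h.symm hB hA hw.symm (by omega)
    refine ⟨a, b, -ε, hab, neg_ne_zero.2 hε, fun j hj => ?_⟩
    rw [neg_mul, ← mul_neg, neg_sub]
    exact hsign j hj
  obtain ⟨ε, hε, hεB⟩ : ∃ ε : ℤ, (ε = 1 ∨ ε = -1) ∧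
      ∀ c : ℤ, (c = 0 ∨ c = 1) → ε * (c - B d') = 0 ∨ ε * (c - B d') = 1 := by
    rcases hB d' with hb | hb
    · exact ⟨1, by simp, fun c hc => by omega⟩
    · exact ⟨-1, by simp, fun c hc => by omega⟩
  have hef := h.fst_lt_snd
  have hsum := h.add_eq_of_suffixSum_eq hw
  obtain ⟨a, b, hab, hsign⟩ := exists_sign_interval (d := d) (σ := ε * σ) (τ := ε * τ)
    (p := if e < d then e else e + 1) (q := if f < d then f else f + 1) (by split_ifs <;> omega)
    (by rcases hε with rfl | rfl <;> have := h.fst_trit <;> omega)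
    (by rcases hε with rfl | rfl <;> have := h.snd_trit <;> omega) (hεB _ (hA d))
    (by rw [← mul_add, ← mul_add, ← add_sub_assoc, hsum, sub_self, mul_zero])
  refine ⟨a, b, ε, hab, by omega, fun j hj => ?_⟩
  convert hsign j (ε * ((if j ≤ d' then B (j - 1) else B d') - B d'))
    (hεB _ (by split_ifs; exacts [hB _, hB _])) using 3 <;>
  · rw [h.suffixSum_sub_eq hdd hj, mul_add, mul_add, mul_ite_zero, mul_ite_zero, mul_ite]

end Alignment

theorem suffixSum_congr {N j : ℕ} {a b : ℕ → ℤ} (h : ∀ i, j ≤ i → i < N → a i = b i) :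
    suffixSum N a j = suffixSum N b j :=
  Finset.sum_congr rfl fun i hi => h i (Finset.mem_Ico.1 hi).1 (Finset.mem_Ico.1 hi).2

theorem suffixSum_eq_of_eq_below {s N : ℕ} {a b : ℕ → ℤ} (hw : suffixSum N a 0 = suffixSum N b 0)
    (hs : s ≤ N) (h : ∀ i < s, a i = b i) : suffixSum N a s = suffixSum N b s := by
  rw [suffixSum_eq_sum_Ico_add s.zero_le hs, suffixSum_eq_sum_Ico_add s.zero_le hs,
    Finset.sum_congr rfl fun i hi => h i (Finset.mem_Ico.1 hi).2] at hw
  exact add_left_cancel hw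

theorem Alignment.eq_of_dvd_window_moments {n s m M d d' e f : ℕ} {A B : ℕ → ℤ} {σ τ : ℤ}
    (h : Alignment n A B d d' e f σ τ) (hA : IsBinary A) (hB : IsBinary B)
    (hw : suffixSum (n + 1) A 0 = suffixSum (n + 1) B 0) (hmM : m ≤ M) (hsm : s + m ≤ n)
    (hwin : ∀ i, A i ≠ B i → s < i ∧ i ≤ s + m)
    (hdvd : ∀ k < 3, 3 * (M : ℤ) ^ (k + 1) ∣ ∑ j ∈ Finset.Ico 1 (m + 1),
      (j : ℤ) ^ k * (suffixSum (n + 1) A (s + j) - suffixSum (n + 1) B (s + j))) : A = B := by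
  set D : ℕ → ℤ := fun j => suffixSum (n + 1) A (s + j) - suffixSum (n + 1) B (s + j) with hD
  have heq {i : ℕ} (hi : ¬(s < i ∧ i ≤ s + m)) : A i = B i := not_not.1 (mt (hwin i) hi)
  have hfirst : D 1 = 0 := sub_eq_zero.2 <|
    suffixSum_eq_of_eq_below hw (by omega) fun i hi => heq (by omega)
  have hlast : D (m + 1) = 0 := sub_eq_zero.2 <|
    suffixSum_congr fun i hi _ => heq (by omega)
  have hmom : ∀ k < 3, ∑ j ∈ Finset.Ico 1 (m + 1), (j : ℤ) ^ k * D j = 0 := fun k hk =>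
    sum_pow_mul_eq_zero_of_dvd three_pos hmM hfirst
      (fun j hj => h.abs_suffixSum_sub_le hA hB (by rw [Finset.mem_Ico] at hj; omega)) (hdvd k hk)
  obtain ⟨a, b, ε, hab, hε, hsign⟩ := h.exists_signs hA hB hw
  have hzero : ∀ j ∈ Finset.Ico 1 (m + 1), ε * D j = 0 := by
    refine eq_zero_of_moments_eq_zero (a := (a : ℤ) - s) (b := (b : ℤ) - s) (by omega)
      (fun j hj hout => ?_) (fun j hj hja hjb => ?_) fun k hk => ?_
    · rw [Finset.mem_Ico] at hj
      exact (hsign (s + j) (by omega)).1 (by omega)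
    · rw [Finset.mem_Ico] at hj
      exact (hsign (s + j) (by omega)).2 (by omega) (by omega)
    · simp only [mul_left_comm _ ε, ← Finset.mul_sum, hmom k hk, mul_zero]
  have hDzero {j : ℕ} (h1 : 1 ≤ j) (hjm : j ≤ m + 1) : D j = 0 := by
    rcases hjm.eq_or_lt with rfl | hjm
    · exact hlast
    · exact (mul_eq_zero.1 (hzero j (Finset.mem_Ico.2 ⟨h1, hjm⟩))).resolve_left hε
  funext i
  by_cases hi : s < i ∧ i ≤ s + m
  · have h1 : D (i - s) = 0 := hDzero (by omega) (by omega)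
    have h2 : D (i - s + 1) = 0 := hDzero (by omega) (by omega)
    simp only [hD, ← add_assoc, Nat.add_sub_cancel' hi.1.le, sub_eq_zero] at h1 h2
    rw [suffixSum_eq_add (show i < n + 1 by omega) A,
      suffixSum_eq_add (show i < n + 1 by omega) B, h2] at h1
    exact add_right_cancel h1
  · exact heq hi

/-! ### Substitutions are far from deletions -/

/-- Every window of length at least `l` has between `4/9` and `5/9` of its length as its weight. -/
def Balanced (l N : ℕ) (a : ℕ → ℤ) : Prop :=
  ∀ i j, 1 ≤ i → i + l ≤ j → j ≤ N →
    4 * ((j : ℤ) - i) ≤ 9 * ∑ k ∈ Finset.Ico i j, a k ∧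
      9 * ∑ k ∈ Finset.Ico i j, a k ≤ 5 * ((j : ℤ) - i)

/-- `A` has no window of length more than `t` with period one or two. -/
def PeriodBounded (n t : ℕ) (A : ℕ → ℤ) : Prop :=
  ∀ a b, 1 ≤ a → b ≤ n → (∀ i, a ≤ i → i + 2 ≤ b → A i = A (i + 2)) → b + 1 ≤ a + t

/-- The properties of two codewords that agree in their global syndromes and differ in two entries
at a distance of at least `4 l`. -/
structure FarPair (n l t : ℕ) (A B : ℕ → ℤ) : Prop where
  period_le : 100 * (t + 2) ≤ l
  isWord_left : IsWord n A
  isWord_right : IsWord n B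
  suffixSum_eq : suffixSum (n + 1) A 0 = suffixSum (n + 1) B 0
  firstMoment_eq : firstMoment (n + 1) A = firstMoment (n + 1) B
  suffixSum_jump_eq : suffixSum (n + 1) (jump A) 0 = suffixSum (n + 1) (jump B) 0
  firstMoment_jump_eq : firstMoment (n + 1) (jump A) = firstMoment (n + 1) (jump B)
  balanced_left : Balanced l (n + 1) A
  balanced_right : Balanced l (n + 1) B
  balanced_jump_left : Balanced l (n + 1) (jump A)
  balanced_jump_right : Balanced l (n + 1) (jump B)
  periodBounded_left : PeriodBounded n t A
  periodBounded_right : PeriodBounded n t B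
  exists_far : ∃ p q, A p ≠ B p ∧ A q ≠ B q ∧ p + 4 * l ≤ q

/-- For an alignment with deletions at `d ≤ d'`: the first substitution is not trivial, and the two
are not much farther apart than the deletions and have distance at least `r` from them. -/
structure SubstitutionsApart (r d d' e f : ℕ) (σ τ : ℤ) : Prop where
  ne_zero : σ ≠ 0
  snd_le : f ≤ e + (d' - d) + 2
  fst_left : e + r ≤ d ∨ d + r ≤ e
  fst_right : e + r ≤ d' ∨ d' + r ≤ e
  snd_left : f + r ≤ d ∨ d + r ≤ f
  snd_right : f + r ≤ d' ∨ d' + r ≤ f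

section LargeGap

variable {d d' e f x W V σ τ s s' b b' α β l : ℤ}

-- The two balance conditions put `x` near the middle by the moments of the words, and away from
-- it by the moments of the jumps.
theorem eq_zero_of_single_substitution (hL : 200 ≤ d' - d)
    (hσ : σ = 0 ∨ σ = 1 ∨ σ = -1) (hb : b = 0 ∨ b = 1) (hb' : b' = 0 ∨ b' = 1)
    (hs : s = 0 ∨ s = 2 ∨ s = -2) (hα : α = 0 ∨ α = 2) (hβ : β = 0 ∨ β = 2)
    (hw : σ + b = b') (hwj : s + α = β)
    (hm : |x * σ + d * b - d' * b' + W| ≤ 2) (hmj : |x * s + d * α - d' * β + V| ≤ 10)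
    (hW : 4 * (d' - d) ≤ 9 * W) (hV : 4 * (d' - d) ≤ 9 * V ∧ 9 * V ≤ 5 * (d' - d))
    (hW' : 9 * W ≤ 5 * (d' - d)) : σ = 0 := by
  rw [abs_le] at hm hmj
  rcases hσ with rfl | rfl | rfl
  · rfl
  all_goals
    rcases hb with rfl | rfl <;> rcases hb' with rfl | rfl <;> try omega
    rcases hs with rfl | rfl | rfl <;> rcases hα with rfl | rfl <;> rcases hβ with rfl | rfl <;>
      omega

theorem gap_of_opposite_substitutions (hL : 200 ≤ d' - d) (hef : e < f)
    (hσ : σ = 0 ∨ σ = 1 ∨ σ = -1) (hb : b = 0 ∨ b = 1) (hστ : σ + τ = 0)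
    (hm : |e * σ + f * τ + d * b - d' * b + W| ≤ 2)
    (hW : 4 * (d' - d) ≤ 9 * W ∧ 9 * W ≤ 5 * (d' - d)) :
    σ ≠ 0 ∧ 4 * (d' - d) - 18 ≤ 9 * (f - e) ∧ 9 * (f - e) ≤ 5 * (d' - d) + 18 := by
  obtain rfl : τ = -σ := by omega
  rw [abs_le] at hm
  rcases hσ with rfl | rfl | rfl <;> rcases hb with rfl | rfl <;>
    refine ⟨?_, ?_, ?_⟩ <;> omega

-- Opposite changes of the jumps would need a gap that is too large or too small, so the jumps
-- see only one of the substitutions.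
theorem jump_substitution_near (hL : 200 ≤ d' - d)
    (hs : s = 0 ∨ s = 2 ∨ s = -2) (hs' : s' = 0 ∨ s' = 2 ∨ s' = -2)
    (hα : α = 0 ∨ α = 2) (hβ : β = 0 ∨ β = 2) (hwj : s + s' + α = β)
    (hmj : |e * s + f * s' + d * α - d' * β + V| ≤ 10)
    (hV : 4 * (d' - d) ≤ 9 * V ∧ 9 * V ≤ 5 * (d' - d))
    (hgap : 4 * (d' - d) - 18 ≤ 9 * (f - e) ∧ 9 * (f - e) ≤ 5 * (d' - d) + 18) :
    |2 * (d' - e) - V| ≤ 10 ∨ |2 * (d' - f) - V| ≤ 10 ∨ |2 * (e - d) - V| ≤ 10 ∨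
      |2 * (f - d) - V| ≤ 10 := by
  simp only [abs_le] at hmj ⊢
  rcases hα with rfl | rfl <;> rcases hβ with rfl | rfl <;>
    rcases hs with rfl | rfl | rfl <;> rcases hs' with rfl | rfl | rfl <;> omega

end LargeGap

namespace Alignment

variable {n l t : ℕ} {A B : ℕ → ℤ} {d d' e f : ℕ} {σ τ : ℤ}

theorem ne_cases (h : Alignment n A B d d' e f σ τ) (hdd : d ≤ d') {i : ℕ} (hi : A i ≠ B i) :
    (d ≤ i ∧ i ≤ d') ∨ (σ ≠ 0 ∧ i < d ∧ i = e) ∨ (τ ≠ 0 ∧ i < d ∧ i = f) ∨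
      (σ ≠ 0 ∧ d' < i ∧ i = e + 1) ∨ (τ ≠ 0 ∧ d' < i ∧ i = f + 1) := by
  rcases Nat.lt_or_ge i d with h1 | h1
  · have := h.deleteAt_sub_apply i
    rw [deleteAt_of_lt A h1, deleteAt_of_lt B (h1.trans_le hdd)] at this
    split_ifs at this <;> omega
  rcases Nat.lt_or_ge d' i with h2 | h2
  · have := h.deleteAt_sub_apply (i - 1)
    rw [deleteAt_of_le A (by omega), deleteAt_of_le B (by omega), Nat.sub_add_cancel (by omega)]
      at this
    split_ifs at this <;> omega
  · exact Or.inl ⟨h1, h2⟩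

theorem substitutionsApart_of_long (H : FarPair n l t A B) (h : Alignment n A B d d' e f σ τ)
    (hdd : d + l ≤ d') : SubstitutionsApart (l / 10) d d' e f σ τ := by
  have hA := H.isWord_left.isBinary
  have hB := H.isWord_right.isBinary
  have hl := H.period_le
  have hef := h.fst_lt_snd
  have hd' := h.right_le
  have hL : 200 ≤ (d' : ℤ) - d := by omega
  obtain ⟨hW, hW'⟩ := H.balanced_right d d' h.one_le_left hdd (by omega)
  have hV := H.balanced_jump_right d d' h.one_le_left hdd (by omega)
  have hw := h.add_eq_of_suffixSum_eq H.suffixSum_eq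
  have hm := h.abs_moment_le (by omega) H.firstMoment_eq
  obtain ⟨s, s', α, β, hs, hs', hs0, hs0', hα, hβ, hwj, hmj⟩ :=
    h.exists_jump_moment hA hB (by omega) H.suffixSum_jump_eq H.firstMoment_jump_eq
  have hsingle_left : τ = 0 → σ = 0 := by
    rintro rfl
    rw [hs0' rfl] at hwj hmj
    exact eq_zero_of_single_substitution hL h.fst_trit (hA d) (hB d') hs hα hβ (by omega)
      (by omega) (by simpa using hm) (by simpa using hmj) hW hV hW'
  have hsingle_right : σ = 0 → τ = 0 := by
    rintro rfl
    rw [hs0 rfl] at hwj hmj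
    exact eq_zero_of_single_substitution hL h.snd_trit (hA d) (hB d') hs' hα hβ (by omega)
      (by omega) (by simpa using hm) (by simpa using hmj) hW hV hW'
  have hστ : σ + τ = 0 := by
    have := h.fst_trit
    have := h.snd_trit
    have := hA d
    have := hB d'
    omega
  obtain ⟨hσ, hgap⟩ := gap_of_opposite_substitutions hL (Int.ofNat_lt.2 hef) h.fst_trit (hA d) hστ
    (by rwa [show B d' = A d by omega] at hm) ⟨hW, hW'⟩
  have hnear := jump_substitution_near hL hs hs' hα hβ hwj hmj hV hgap
  simp only [abs_le] at hnear
  constructor <;> omega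

theorem substitutionsApart_of_short (H : FarPair n l t A B) (h : Alignment n A B d d' e f σ τ)
    (hdd : d ≤ d') (hL : d' < d + l) : SubstitutionsApart (l / 10) d d' e f σ τ := by
  have hl := H.period_le
  have hef := h.fst_lt_snd
  have hW0 : 0 ≤ ∑ i ∈ Finset.Ico d d', B i := Finset.sum_nonneg fun i _ => by
    rcases H.isWord_right.isBinary i with h | h <;> omega
  have hW1 : ∑ i ∈ Finset.Ico d d', B i ≤ d' - d := by
    refine (Finset.sum_le_card_nsmul _ _ 1 fun i _ => by
      rcases H.isWord_right.isBinary i with h | h <;> omega).trans ?_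
    rw [Nat.card_Ico, nsmul_one, Nat.cast_sub hdd]
  have hb := H.isWord_left.isBinary d
  have hb' := H.isWord_right.isBinary d'
  have hw := h.add_eq_of_suffixSum_eq H.suffixSum_eq
  have hm := abs_le.1 (h.abs_moment_le hdd H.firstMoment_eq)
  obtain ⟨p, q, hp, hq, hpq⟩ := H.exists_far
  have hp := h.ne_cases hdd hp
  have hq := h.ne_cases hdd hq
  -- A single substitution would have to lie next to the interval of the deletions.
  have hστ : σ + τ = 0 ∧ σ ≠ 0 := by
    rcases h.fst_trit with hσ | hσ | hσ <;> rcases h.snd_trit with hτ | hτ | hτ <;>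
      rcases hb with hb | hb <;> rcases hb' with hb' | hb' <;>
      rw [hσ, hτ, hb, hb'] at hw hm <;> omega
  have hgap : f ≤ e + (d' - d) + 2 := by
    obtain rfl : τ = -σ := by omega
    rw [show B d' = A d by omega] at hm
    rcases h.fst_trit with hσ | hσ | hσ <;> rcases hb with hb | hb <;>
      rw [hσ, hb] at hm <;> omega
  constructor <;> omega

theorem substitutionsApart (H : FarPair n l t A B) (h : Alignment n A B d d' e f σ τ)
    (hdd : d ≤ d') : SubstitutionsApart (l / 10) d d' e f σ τ := by
  rcases Nat.lt_or_ge d' (d + l) with hL | hL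
  · exact substitutionsApart_of_short H h hdd hL
  · exact substitutionsApart_of_long H h hL

end Alignment

theorem FarPair.symm {n l t : ℕ} {A B : ℕ → ℤ} (h : FarPair n l t A B) : FarPair n l t B A where
  period_le := h.period_le
  isWord_left := h.isWord_right
  isWord_right := h.isWord_left
  suffixSum_eq := h.suffixSum_eq.symm
  firstMoment_eq := h.firstMoment_eq.symm
  suffixSum_jump_eq := h.suffixSum_jump_eq.symm
  firstMoment_jump_eq := h.firstMoment_jump_eq.symm
  balanced_left := h.balanced_right
  balanced_right := h.balanced_left
  balanced_jump_left := h.balanced_jump_right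
  balanced_jump_right := h.balanced_jump_left
  periodBounded_left := h.periodBounded_right
  periodBounded_right := h.periodBounded_left
  exists_far := by simpa only [ne_comm] using h.exists_far

theorem FarPair.deleteAt_ne {n l t : ℕ} {A B : ℕ → ℤ} {d d' e f : ℕ} {σ τ : ℤ}
    (H : FarPair n l t A B) (h : Alignment n A B d d' e f σ τ) : deleteAt A d ≠ deleteAt B d' := by
  have hσ : σ ≠ 0 := by
    rcases le_total d d' with hdd | hdd
    · exact (h.substitutionsApart H hdd).ne_zero
    · exact neg_ne_zero.1 (h.symm.substitutionsApart H.symm hdd).ne_zero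
  intro heq
  have := h.deleteAt_sub_apply e
  rw [heq, if_pos rfl, if_neg h.fst_lt_snd.ne, sub_self, add_zero] at this
  exact hσ this.symm

/-! ### At most four pairs of deletions -/

theorem deleteAt_eq_of_const {a : ℕ → ℤ} {d c : ℕ} (hdc : d ≤ c)
    (h : ∀ i, d ≤ i → i < c → a i = a (i + 1)) : deleteAt a d = deleteAt a c := by
  funext i
  rcases Nat.lt_or_ge i d with h1 | h1
  · rw [deleteAt_of_lt a h1, deleteAt_of_lt a (h1.trans_le hdc)]
  rcases Nat.lt_or_ge i c with h2 | h2
  · rw [deleteAt_of_le a h1, deleteAt_of_lt a h2, h i h1 h2]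
  · rw [deleteAt_of_le a h1, deleteAt_of_le a h2]

theorem exists_free_interval {S : Finset ℕ} {k : ℕ} (hS : S.card ≤ k) (D : ℕ) {m : ℕ}
    (hm : 0 < m) : ∃ a, D ≤ a ∧ a + m ≤ D + (k + 1) * m ∧ ∀ c ∈ S, c < a ∨ a + m ≤ c := by
  obtain ⟨j, hj, hjS⟩ := Finset.exists_mem_notMem_of_card_lt_card
    (s := S.image fun c => (c - D) / m) (t := Finset.range (k + 1))
    (by rw [Finset.card_range]; exact Nat.lt_succ_of_le (Finset.card_image_le.trans hS))
  have hj := Nat.mul_le_mul_right m (Finset.mem_range.1 hj)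
  rw [Nat.succ_mul] at hj
  refine ⟨D + j * m, by omega, by omega, fun c hc => ?_⟩
  by_contra! hcon
  refine hjS (Finset.mem_image.2 ⟨c, hc, ?_⟩)
  rw [Nat.div_eq_iff hm]
  omega

theorem PeriodBounded.false_of_shift_of_eq {n t a c : ℕ} {A B : ℕ → ℤ} (h : PeriodBounded n t A)
    (ha : 1 ≤ a) (hac : a + t ≤ c) (hc : c ≤ n)
    (hshift : ∀ i, a ≤ i → i < c → A (i + 1) = B i) (heq : ∀ i, a ≤ i → i < c → A i = B i) :
    False := by
  have := h a c ha hc fun i h1 h2 => by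
    rw [heq i h1 (by omega), ← hshift i h1 (by omega), heq (i + 1) (by omega) (by omega),
      hshift (i + 1) (by omega) (by omega)]
  omega

namespace Alignment

variable {n l t : ℕ} {A B : ℕ → ℤ} {d d' e f d₂ d₂' e₂ f₂ : ℕ} {σ τ σ₂ τ₂ : ℤ}

section Regions

variable {i c : ℕ}

theorem apply_eq_of_lt (h : Alignment n A B d d' e f σ τ) (hdd : d ≤ d') (hi : i < d)
    (he : i ≠ e) (hf : i ≠ f) : A i = B i := by
  have := h.deleteAt_sub_apply i
  rwa [deleteAt_of_lt A hi, deleteAt_of_lt B (hi.trans_le hdd), if_neg he, if_neg hf, add_zero,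
    sub_eq_zero] at this

theorem apply_succ_eq (h : Alignment n A B d d' e f σ τ) (hi : d ≤ i) (hi' : i < d')
    (he : i ≠ e) (hf : i ≠ f) : A (i + 1) = B i := by
  have := h.deleteAt_sub_apply i
  rwa [deleteAt_of_le A hi, deleteAt_of_lt B hi', if_neg he, if_neg hf, add_zero,
    sub_eq_zero] at this

theorem apply_succ_eq_of_le (h : Alignment n A B d d' e f σ τ) (hdd : d ≤ d') (hi : d' ≤ i)
    (he : i ≠ e) (hf : i ≠ f) : A (i + 1) = B (i + 1) := by
  have := h.deleteAt_sub_apply i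
  rwa [deleteAt_of_le A (hdd.trans hi), deleteAt_of_le B hi, if_neg he, if_neg hf, add_zero,
    sub_eq_zero] at this

-- Every interval of length `5 m` contains one of length `m` that avoids `d`, `d'`, `e` and `f`.
theorem exists_window (h : Alignment n A B d d' e f σ τ) (hdd : d ≤ d') (D : ℕ) {m : ℕ}
    (hm : 0 < m) : ∃ a, D ≤ a ∧ a + m ≤ D + 5 * m ∧
      ((a + m ≤ d ∧ ∀ i, a ≤ i → i < a + m → A i = B i) ∨
        (d < a ∧ a + m ≤ d' ∧ ∀ i, a ≤ i → i < a + m → A (i + 1) = B i) ∨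
        (d' < a ∧ ∀ i, a ≤ i → i < a + m → A (i + 1) = B (i + 1))) := by
  obtain ⟨a, ha, ham, hfree⟩ :=
    exists_free_interval (S := {d, d', e, f}) Finset.card_le_four D hm
  simp only [Finset.mem_insert, Finset.mem_singleton, forall_eq_or_imp, forall_eq] at hfree
  refine ⟨a, ha, ham, ?_⟩
  rcases hfree.1 with h1 | h1
  · rcases hfree.2.1 with h2 | h2
    · exact .inr (.inr ⟨h2, fun i _ _ =>
        h.apply_succ_eq_of_le hdd (by omega) (by omega) (by omega)⟩)
    · exact .inr (.inl ⟨h1, h2, fun i _ _ =>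
        h.apply_succ_eq (by omega) (by omega) (by omega) (by omega)⟩)
  · exact .inl ⟨h1, fun i _ _ => h.apply_eq_of_lt hdd (by omega) (by omega) (by omega)⟩

theorem deleteAt_left_eq (h : Alignment n A B d d' e f σ τ) (hdc : d ≤ c) (hcd : c ≤ d')
    (hfree : ∀ i, d ≤ i → i < c → i ≠ e ∧ i ≠ f) (heq : ∀ i, d ≤ i → i < c → A i = B i) :
    deleteAt A d = deleteAt A c :=
  deleteAt_eq_of_const hdc fun i h1 h2 => by
    rw [heq i h1 h2, h.apply_succ_eq h1 (by omega) (hfree i h1 h2).1 (hfree i h1 h2).2]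

theorem deleteAt_right_eq (h : Alignment n A B d d' e f σ τ) (hdc : d ≤ c) (hcd : c ≤ d')
    (hfree : ∀ i, c ≤ i → i < d' → i ≠ e ∧ i ≠ f)
    (heq : ∀ i, c ≤ i → i < d' → A (i + 1) = B (i + 1)) : deleteAt B d' = deleteAt B c :=
  (deleteAt_eq_of_const hcd fun i h1 h2 => by
    rw [← heq i h1 h2, h.apply_succ_eq (by omega) h2 (hfree i h1 h2).1 (hfree i h1 h2).2]).symm

end Regions

section LongShift

theorem false_of_long_of_opposite (H : FarPair n l t A B) (h : Alignment n A B d d' e f σ τ)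
    (hL : d + l / 10 ≤ d') (h₂ : Alignment n B A d₂' d₂ e₂ f₂ σ₂ τ₂) (hdd₂ : d₂' ≤ d₂) :
    False := by
  have hl := H.period_le
  have hd := h.one_le_left
  have hd' := h.right_le
  have apart := h.substitutionsApart H (by omega)
  have := apart.fst_left
  have := apart.snd_left
  obtain ⟨a, ha, ham, hcase⟩ := h₂.exists_window hdd₂ d (m := t + 2) (by omega)
  have hshift : ∀ i, a ≤ i → i < a + (t + 2) → A (i + 1) = B i := fun i _ _ =>
    h.apply_succ_eq (by omega) (by omega) (by omega) (by omega)
  rcases hcase with ⟨-, heq⟩ | ⟨-, -, hshift₂⟩ | ⟨-, heq⟩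
  · exact H.periodBounded_left.false_of_shift_of_eq (by omega) (by omega) (by omega) hshift
      fun i h1 h2 => (heq i h1 h2).symm
  · -- Opposite shifts produce period two.
    have := H.periodBounded_left a (a + (t + 2)) (by omega) (by omega) fun i h1 h2 => by
      rw [hshift (i + 1) (by omega) (by omega), hshift₂ i h1 (by omega)]
    omega
  · exact H.periodBounded_left.false_of_shift_of_eq (a := a + 1) (c := a + (t + 2)) (by omega)
      (by omega) (by omega) (fun i h1 h2 => hshift i (by omega) h2) fun i h1 h2 => by
        obtain ⟨i, rfl⟩ := Nat.exists_eq_add_of_le' (show 1 ≤ i by omega)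
        exact (heq i (by omega) (by omega)).symm

-- Otherwise `A` would be constant on a window on which one alignment shifts and the other does not.
theorem overlap (H : FarPair n l t A B) (h : Alignment n A B d d' e f σ τ)
    (h₂ : Alignment n A B d₂ d₂' e₂ f₂ σ₂ τ₂) (hdd₂ : d₂ ≤ d₂') {D : ℕ} (hD : d ≤ D)
    (hD' : D + 5 * (t + 2) ≤ d')
    (hfree : ∀ i, D ≤ i → i < D + 5 * (t + 2) → i ≠ e ∧ i ≠ f) :
    d₂ < D + 5 * (t + 2) ∧ D < d₂' := by
  have hd := h.one_le_left
  have hd' := h.right_le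
  obtain ⟨a, ha, ham, hcase⟩ := h₂.exists_window hdd₂ D (m := t + 2) (by omega)
  have hshift : ∀ i, a ≤ i → i < a + (t + 2) → A (i + 1) = B i := fun i _ _ =>
    have hef := hfree i (by omega) (by omega)
    h.apply_succ_eq (by omega) (by omega) hef.1 hef.2
  rcases hcase with ⟨-, heq⟩ | ⟨hda, had, -⟩ | ⟨-, heq⟩
  · exact (H.periodBounded_left.false_of_shift_of_eq (by omega) (by omega) (by omega) hshift
      heq).elim
  · omega
  · refine (H.periodBounded_left.false_of_shift_of_eq (a := a + 1) (c := a + (t + 2)) (by omega)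
      (by omega) (by omega) (fun i h1 h2 => hshift i (by omega) h2) fun i h1 h2 => ?_).elim
    obtain ⟨i, rfl⟩ := Nat.exists_eq_add_of_le' (show 1 ≤ i by omega)
    exact heq i (by omega) (by omega)

theorem ends_near_of_long (H : FarPair n l t A B) (h : Alignment n A B d d' e f σ τ)
    (hL : d + l / 10 ≤ d') (h₂ : Alignment n A B d₂ d₂' e₂ f₂ σ₂ τ₂) (hdd₂ : d₂ ≤ d₂') :
    (d₂ < d + 5 * (t + 2) ∧ d < d₂ + 5 * (t + 2)) ∧
      (d' < d₂' + 5 * (t + 2) ∧ d₂' < d' + 5 * (t + 2)) := by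
  have hl := H.period_le
  have hdd : d ≤ d' := by omega
  obtain ⟨-, -, he, he', hf, hf'⟩ := h.substitutionsApart H hdd
  obtain ⟨-, -, he₂, he₂', hf₂, hf₂'⟩ := h₂.substitutionsApart H hdd₂
  obtain ⟨hstart, hd⟩ := h.overlap H h₂ hdd₂ (D := d) le_rfl (by omega)
    fun i _ _ => ⟨by omega, by omega⟩
  obtain ⟨hd', hend⟩ := h.overlap H h₂ hdd₂ (D := d' - 5 * (t + 2)) (by omega) (by omega)
    fun i _ _ => ⟨by omega, by omega⟩
  refine ⟨⟨hstart, ?_⟩, by omega, ?_⟩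
  · by_contra! hcon
    have := h₂.overlap H h hdd (D := d₂) le_rfl (by omega) fun i _ _ => ⟨by omega, by omega⟩
    omega
  · by_contra! hcon
    have := h₂.overlap H h hdd (D := d₂' - 5 * (t + 2)) (by omega) (by omega)
      fun i _ _ => ⟨by omega, by omega⟩
    omega

theorem deleteAt_eq_of_long (H : FarPair n l t A B) (h : Alignment n A B d d' e f σ τ)
    (hL : d + l / 10 ≤ d') (h₂ : Alignment n A B d₂ d₂' e₂ f₂ σ₂ τ₂) (hdd₂ : d₂ ≤ d₂') :
    deleteAt A d₂ = deleteAt A d ∧ deleteAt B d₂' = deleteAt B d' := by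
  have hl := H.period_le
  have hdd : d ≤ d' := by omega
  obtain ⟨-, -, he, he', hf, hf'⟩ := h.substitutionsApart H hdd
  obtain ⟨-, -, he₂, he₂', hf₂, hf₂'⟩ := h₂.substitutionsApart H hdd₂
  obtain ⟨hstart, hend⟩ := h.ends_near_of_long H hL h₂ hdd₂
  constructor
  · rcases le_total d d₂ with hc | hc
    · exact (h.deleteAt_left_eq hc (by omega) (fun i _ _ => by omega) fun i _ hi =>
        h₂.apply_eq_of_lt hdd₂ hi (by omega) (by omega)).symm
    · exact h₂.deleteAt_left_eq hc (by omega) (fun i _ _ => by omega) fun i _ hi =>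
        h.apply_eq_of_lt hdd hi (by omega) (by omega)
  · rcases le_total d' d₂' with hc | hc
    · exact h₂.deleteAt_right_eq (by omega) hc (fun i _ _ => by omega) fun i hi _ =>
        h.apply_succ_eq_of_le hdd hi (by omega) (by omega)
    · exact (h.deleteAt_right_eq (by omega) hc (fun i _ _ => by omega) fun i hi _ =>
        h₂.apply_succ_eq_of_le hdd₂ hi (by omega) (by omega)).symm

end LongShift

end Alignment

/-- The first and the last of the places at most `p₁ + 2 l` where `A` and `B` differ, where `p₁` is
the first of all, and the first and the last of the later places. -/
structure DifferenceClusters (l : ℕ) (A B : ℕ → ℤ) (p₁ q₁ p₂ q₂ : ℕ) : Prop where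
  isLeast_fst : IsLeast {i | A i ≠ B i} p₁
  isGreatest_fst : IsGreatest {i | A i ≠ B i ∧ i ≤ p₁ + 2 * l} q₁
  isLeast_snd : IsLeast {i | A i ≠ B i ∧ p₁ + 2 * l < i} p₂
  isGreatest_snd : IsGreatest {i | A i ≠ B i} q₂
  add_le : p₁ + 4 * l ≤ q₂

namespace DifferenceClusters

variable {l : ℕ} {A B : ℕ → ℤ} {p₁ q₁ p₂ q₂ i : ℕ}

theorem symm (h : DifferenceClusters l A B p₁ q₁ p₂ q₂) :
    DifferenceClusters l B A p₁ q₁ p₂ q₂ where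
  isLeast_fst := by simpa only [ne_comm] using h.isLeast_fst
  isGreatest_fst := by simpa only [ne_comm] using h.isGreatest_fst
  isLeast_snd := by simpa only [ne_comm] using h.isLeast_snd
  isGreatest_snd := by simpa only [ne_comm] using h.isGreatest_snd
  add_le := h.add_le

theorem apply_eq_of_lt (h : DifferenceClusters l A B p₁ q₁ p₂ q₂) (hi : i < p₁) : A i = B i :=
  not_not.1 fun hne => hi.not_ge (h.isLeast_fst.2 hne)

theorem apply_eq_of_gt (h : DifferenceClusters l A B p₁ q₁ p₂ q₂) (hi : q₂ < i) : A i = B i :=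
  not_not.1 fun hne => hi.not_ge (h.isGreatest_snd.2 hne)

theorem apply_eq_between (h : DifferenceClusters l A B p₁ q₁ p₂ q₂) (hq : q₁ < i) (hp : i < p₂) :
    A i = B i := by
  by_contra hne
  rcases Nat.lt_or_ge (p₁ + 2 * l) i with hi | hi
  · exact hp.not_ge (h.isLeast_snd.2 ⟨hne, hi⟩)
  · exact hq.not_ge (h.isGreatest_fst.2 ⟨hne, hi⟩)

end DifferenceClusters

section

variable {n l t : ℕ} {A B : ℕ → ℤ} {d d' e f p₁ q₁ p₂ q₂ : ℕ} {σ τ : ℤ}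

theorem FarPair.exists_differenceClusters (H : FarPair n l t A B) :
    ∃ p₁ q₁ p₂ q₂, DifferenceClusters l A B p₁ q₁ p₂ q₂ := by
  classical
  have hl := H.period_le
  have hbound : BddAbove {i | A i ≠ B i} := ⟨n, fun i hi => by
    by_contra! hni
    exact hi (by rw [H.isWord_left.eq_zero_of_lt i hni, H.isWord_right.eq_zero_of_lt i hni])⟩
  obtain ⟨p, q, hp, hq, hpq⟩ := H.exists_far
  obtain ⟨q₂, hq₂⟩ := hbound.exists_isGreatest_of_nonempty ⟨p, hp⟩
  have hp₁ := Nat.isLeast_find (p := fun i => A i ≠ B i) ⟨p, hp⟩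
  set p₁ := Nat.find (p := fun i => A i ≠ B i) ⟨p, hp⟩
  have hfar : p₁ + 4 * l ≤ q₂ := by
    have := hp₁.2 hp
    have := hq₂.2 hq
    omega
  have hbound₁ : BddAbove {i | A i ≠ B i ∧ i ≤ p₁ + 2 * l} := ⟨_, fun _ hi => hi.2⟩
  obtain ⟨q₁, hq₁⟩ := hbound₁.exists_isGreatest_of_nonempty ⟨p₁, hp₁.1, by omega⟩
  exact ⟨p₁, q₁, _, q₂, hp₁, hq₁,
    Nat.isLeast_find (p := fun i => A i ≠ B i ∧ p₁ + 2 * l < i) ⟨q₂, hq₂.1, by omega⟩, hq₂, hfar⟩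

theorem Alignment.deleteAt_eq_of_short (H : FarPair n l t A B)
    (C : DifferenceClusters l A B p₁ q₁ p₂ q₂) (h : Alignment n A B d d' e f σ τ) (hdd : d ≤ d')
    (hL : d' < d + l / 10) :
    (deleteAt A d = deleteAt A p₁ ∧ deleteAt B d' = deleteAt B q₁) ∨
      (deleteAt A d = deleteAt A p₂ ∧ deleteAt B d' = deleteAt B q₂) := by
  have hl := H.period_le
  have hef := h.fst_lt_snd
  obtain ⟨-, hgap, he, he', hf, hf'⟩ := h.substitutionsApart H hdd
  have hfar := C.add_le
  have hp₁ := h.ne_cases hdd C.isLeast_fst.1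
  have hq₁ := h.ne_cases hdd C.isGreatest_fst.1.1
  have hp₂ := h.ne_cases hdd C.isLeast_snd.1.1
  have hq₂ := h.ne_cases hdd C.isGreatest_snd.1
  have hq₁_le := C.isGreatest_fst.1.2
  have hlt_p₂ := C.isLeast_snd.1.2
  have hpq₁ : p₁ ≤ q₁ := C.isLeast_fst.2 C.isGreatest_fst.1.1
  have hpq₂ : p₂ ≤ q₂ := C.isGreatest_snd.2 C.isLeast_snd.1.1
  -- The deletions form one of the two clusters, the substitutions the other one.
  by_cases hside : d' + l / 10 ≤ e
  · exact .inl ⟨h.deleteAt_left_eq (by omega) (by omega) (fun i _ _ => by omega) fun i _ hi =>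
        C.apply_eq_of_lt hi,
      h.deleteAt_right_eq (by omega) (by omega) (fun i _ _ => by omega) fun i _ _ =>
        C.apply_eq_between (by omega) (by omega)⟩
  · exact .inr ⟨h.deleteAt_left_eq (by omega) (by omega) (fun i _ _ => by omega) fun i _ hi =>
        C.apply_eq_between (by omega) hi,
      h.deleteAt_right_eq (by omega) (by omega) (fun i _ _ => by omega) fun i _ _ =>
        C.apply_eq_of_gt (by omega)⟩

theorem FarPair.exists_four_deletions (H : FarPair n l t A B) :
    ∃ c c' : Fin 4 → ℕ, ∀ d d' e f σ τ, Alignment n A B d d' e f σ τ →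
      ∃ k, deleteAt A d = deleteAt A (c k) ∧ deleteAt B d' = deleteAt B (c' k) := by
  by_cases hlong : ∃ d d' e f σ τ, Alignment n A B d d' e f σ τ ∧ d + l / 10 ≤ d'
  · obtain ⟨d, d', e, f, σ, τ, h, hL⟩ := hlong
    refine ⟨fun _ => d, fun _ => d', fun d₂ d₂' e₂ f₂ σ₂ τ₂ h₂ => ⟨0, ?_⟩⟩
    rcases le_total d₂ d₂' with hdd | hdd
    · exact h.deleteAt_eq_of_long H hL h₂ hdd
    · exact (h.false_of_long_of_opposite H hL h₂.symm hdd).elim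
  by_cases hlong' : ∃ d d' e f σ τ, Alignment n A B d d' e f σ τ ∧ d' + l / 10 ≤ d
  · obtain ⟨d, d', e, f, σ, τ, h, hL⟩ := hlong'
    refine ⟨fun _ => d, fun _ => d', fun d₂ d₂' e₂ f₂ σ₂ τ₂ h₂ => ⟨0, ?_⟩⟩
    rcases le_total d₂' d₂ with hdd | hdd
    · exact (h.symm.deleteAt_eq_of_long H.symm hL h₂.symm hdd).symm
    · exact (h.symm.false_of_long_of_opposite H.symm hL h₂ hdd).elim
  push Not at hlong hlong'
  obtain ⟨p₁, q₁, p₂, q₂, C⟩ := H.exists_differenceClusters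
  refine ⟨![p₁, p₂, q₁, q₂], ![q₁, q₂, p₁, p₂], fun d d' e f σ τ h => ?_⟩
  rcases le_total d d' with hdd | hdd
  · rcases h.deleteAt_eq_of_short H C hdd (hlong _ _ _ _ _ _ h) with h | h
    exacts [⟨0, h⟩, ⟨1, h⟩]
  · rcases h.symm.deleteAt_eq_of_short H.symm C.symm hdd (hlong' _ _ _ _ _ _ h) with h | h
    exacts [⟨2, h.symm⟩, ⟨3, h.symm⟩]

end

/-! ### Codewords -/

/-- The blocks `c + 1` and `c + 2` of `x`, joined; the syndromes `oddPairVT` and `evenPairVT` sum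
over the even and the odd `c`, respectively. -/
def blockPair (P : ℕ) (x : List Bool) (c : ℕ) : List Bool := (x.drop (c * P)).take (2 * P)

section BlockPairs

variable {P c j k M : ℕ} {x y : List Bool}

theorem block_append_block (P : ℕ) (x : List Bool) (c : ℕ) :
    block P x (c + 1) ++ block P x (c + 2) = blockPair P x c := by
  unfold block blockPair
  rw [show c + 1 - 1 = c by omega, show c + 2 - 1 = c + 1 by omega, two_mul, List.take_add,
    List.drop_drop, show c * P + P = (c + 1) * P by ring]

theorem length_blockPair (P : ℕ) (x : List Bool) (c : ℕ) :
    (blockPair P x c).length = min (2 * P) (x.length - c * P) := by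
  simp [blockPair]

theorem toSeq_blockPair (x : List Bool) (c : ℕ) (hj : 1 ≤ j) (hjP : j ≤ 2 * P) :
    toSeq (blockPair P x c) j = toSeq x (c * P + j) := by
  obtain ⟨j, rfl⟩ := Nat.exists_eq_add_of_le' hj
  rw [← add_assoc, toSeq_succ, toSeq_succ]
  simp [blockPair, List.getD_eq_getElem?_getD, show j < 2 * P by omega]

theorem blockPair_congr (hl : x.length = y.length)
    (h : ∀ i, c * P < i → i ≤ c * P + 2 * P → toSeq x i = toSeq y i) :
    blockPair P x c = blockPair P y c := by
  have hl' : (blockPair P x c).length = (blockPair P y c).length := by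
    rw [length_blockPair, length_blockPair, hl]
  refine toSeq_injective hl' (funext fun j => ?_)
  obtain rfl | hj := Nat.eq_zero_or_pos j
  · rfl
  obtain hjP | hjP := Nat.lt_or_ge (2 * P) j
  · have hlen := length_blockPair P x c
    rw [(isWord_toSeq _).eq_zero_of_lt j (by omega), (isWord_toSeq _).eq_zero_of_lt j (by omega)]
  · rw [toSeq_blockPair x c hj hjP, toSeq_blockPair y c hj hjP, h _ (by omega) (by omega)]

theorem suffixSum_blockPair (x : List Bool) (hj : 1 ≤ j) :
    suffixSum ((blockPair P x c).length + 1) (toSeq (blockPair P x c)) j =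
      ∑ i ∈ Finset.Ico (c * P + j) (c * P + ((blockPair P x c).length + 1)), toSeq x i := by
  have hlen := length_blockPair P x c
  rw [suffixSum, add_comm _ j, add_comm _ (_ + 1), ← Finset.sum_Ico_add']
  refine Finset.sum_congr rfl fun i hi => ?_
  rw [Finset.mem_Ico] at hi
  rw [toSeq_blockPair x c (by omega) (by omega), add_comm]

theorem VT_blockPair_sub (hl : x.length = y.length)
    (h : ∀ i, toSeq x i ≠ toSeq y i → i ≤ c * P + 2 * P) (k : ℕ) :
    (VT (k + 1) (blockPair P x c) : ℤ) - VT (k + 1) (blockPair P y c) =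
      ∑ j ∈ Finset.Ico 1 ((blockPair P x c).length + 1), (j : ℤ) ^ k *
        (suffixSum (x.length + 1) (toSeq x) (c * P + j) -
          suffixSum (x.length + 1) (toSeq y) (c * P + j)) := by
  have hlen := length_blockPair P x c
  have hlen' : (blockPair P y c).length = (blockPair P x c).length := by
    rw [hlen, length_blockPair, hl]
  have htail : suffixSum (x.length + 1) (toSeq x) (c * P + ((blockPair P x c).length + 1)) =
      suffixSum (x.length + 1) (toSeq y) (c * P + ((blockPair P x c).length + 1)) :=
    suffixSum_congr fun i hi hiN => by
      by_contra hne
      have := h i hne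
      omega
  rw [VT_succ_eq, VT_succ_eq, hlen', ← Finset.sum_sub_distrib]
  refine Finset.sum_congr rfl fun j hj => ?_
  rw [Finset.mem_Ico] at hj
  have hy := suffixSum_blockPair (P := P) (c := c) y hj.1
  rw [hlen'] at hy
  have hsplit := suffixSum_eq_sum_Ico_add (N := x.length + 1)
    (show c * P + j ≤ c * P + ((blockPair P x c).length + 1) by omega) (by omega)
  rw [← mul_sub, suffixSum_blockPair x hj.1, hy, hsplit, hsplit, htail, add_sub_add_right_eq_sub]

theorem oddPairVT_eq (P k : ℕ) (x : List Bool) :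
    oddPairVT P k x =
      ∑ i ∈ Finset.Icc 1 (x.length / P + 1), VT k (blockPair P x (2 * i - 2)) := by
  refine Finset.sum_congr rfl fun i hi => ?_
  have hi := (Finset.mem_Icc.1 hi).1
  rw [← block_append_block, show 2 * i - 2 + 1 = 2 * i - 1 by omega,
    show 2 * i - 2 + 2 = 2 * i by omega]

theorem evenPairVT_eq (P k : ℕ) (x : List Bool) :
    evenPairVT P k x =
      ∑ i ∈ Finset.Icc 1 (x.length / P + 1), VT k (blockPair P x (2 * i - 1)) := by
  refine Finset.sum_congr rfl fun i hi => ?_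
  have hi := (Finset.mem_Icc.1 hi).1
  rw [← block_append_block, show 2 * i - 1 + 1 = 2 * i by omega,
    show 2 * i - 1 + 2 = 2 * i + 1 by omega]

theorem modEq_of_sum_modEq {ι : Type*} {s : Finset ι} {f g : ι → ℕ} {i₀ : ι} (hi₀ : i₀ ∈ s)
    (hfg : ∀ i ∈ s, i ≠ i₀ → f i = g i) (h : ∑ i ∈ s, f i ≡ ∑ i ∈ s, g i [MOD M]) :
    f i₀ ≡ g i₀ [MOD M] := by
  classical
  rw [← Finset.add_sum_erase s f hi₀, ← Finset.add_sum_erase s g hi₀,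
    Finset.sum_congr rfl fun i hi => hfg i (Finset.mem_of_mem_erase hi) (Finset.ne_of_mem_erase hi)]
    at h
  exact h.add_right_cancel' _

-- The pair of blocks `c` belongs to one of the two families, by the parity of `c`, and is disjoint
-- from the other pairs of that family.
theorem VT_blockPair_modEq (hl : x.length = y.length) (hc : c ≤ x.length / P)
    (h : ∀ i, toSeq x i ≠ toSeq y i → c * P < i ∧ i ≤ c * P + 2 * P)
    (ho : oddPairVT P k x ≡ oddPairVT P k y [MOD M])
    (he : evenPairVT P k x ≡ evenPairVT P k y [MOD M]) :
    VT k (blockPair P x c) ≡ VT k (blockPair P y c) [MOD M] := by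
  have hdisjoint {c' : ℕ} (hc' : c' + 2 ≤ c ∨ c + 2 ≤ c') :
      VT k (blockPair P x c') = VT k (blockPair P y c') :=
    congrArg _ <| blockPair_congr hl fun i h1 h2 => by
      by_contra hne
      have := h i hne
      obtain hc' | hc' := hc' <;> have := Nat.mul_le_mul_right P hc' <;> grind
  obtain ⟨b, rfl | rfl⟩ := Nat.even_or_odd' c
  · rw [oddPairVT_eq, oddPairVT_eq, ← hl] at ho
    have := modEq_of_sum_modEq (i₀ := b + 1) (Finset.mem_Icc.2 ⟨by omega, by omega⟩)
      (fun i hi hne => hdisjoint (by rw [Finset.mem_Icc] at hi; omega)) ho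
    simpa [mul_add] using this
  · rw [evenPairVT_eq, evenPairVT_eq, ← hl] at he
    have := modEq_of_sum_modEq (i₀ := b + 1) (Finset.mem_Icc.2 ⟨by omega, by omega⟩)
      (fun i hi hne => hdisjoint (by rw [Finset.mem_Icc] at hi; omega)) he
    simpa [mul_add] using this

end BlockPairs

theorem IsWord.exists_block_of_near {n P : ℕ} {A B : ℕ → ℤ} (hA : IsWord n A) (hB : IsWord n B)
    (hAB : A ≠ B) (hnear : ∀ i j, A i ≠ B i → A j ≠ B j → j < i + P) :
    ∃ c ≤ n / P, ∀ i, A i ≠ B i → c * P < i ∧ i ≤ c * P + 2 * P ∧ i ≤ n := by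
  classical
  have hex := Function.ne_iff.1 hAB
  have hmin {i : ℕ} (hi : A i ≠ B i) : Nat.find hex ≤ i := Nat.find_min' hex hi
  have hrange {i : ℕ} (hi : A i ≠ B i) : 1 ≤ i ∧ i ≤ n := by
    constructor <;> by_contra! hc
    · obtain rfl := Nat.lt_one_iff.1 hc
      exact hi (by rw [hA.zero, hB.zero])
    · exact hi (by rw [hA.eq_zero_of_lt i hc, hB.eq_zero_of_lt i hc])
  have ha := Nat.find_spec hex
  set a := Nat.find hex
  have ha1 := hrange ha
  have hP : 0 < P := Nat.pos_of_lt_add_right (hnear a a ha ha)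
  have hle := Nat.div_mul_le_self (a - 1) P
  have hlt := Nat.lt_div_mul_add (a := a - 1) hP
  refine ⟨(a - 1) / P, Nat.div_le_div_right (by omega), fun i hi => ?_⟩
  have := hnear a i ha hi
  have := hmin hi
  have := hrange hi
  omega

theorem Alignment.eq_of_pairVT_modEq {P n d d' e f : ℕ} {σ τ : ℤ} {x y : List Bool}
    (hx : x.length = n) (hy : y.length = n) (h : Alignment n (toSeq x) (toSeq y) d d' e f σ τ)
    (hw : suffixSum (n + 1) (toSeq x) 0 = suffixSum (n + 1) (toSeq y) 0)
    (hnear : ∀ i j, toSeq x i ≠ toSeq y i → toSeq x j ≠ toSeq y j → j < i + P)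
    (ho : ∀ k < 3, oddPairVT P (k + 1) x ≡ oddPairVT P (k + 1) y [MOD 3 * (2 * P) ^ (k + 1)])
    (he : ∀ k < 3, evenPairVT P (k + 1) x ≡ evenPairVT P (k + 1) y [MOD 3 * (2 * P) ^ (k + 1)]) :
    x = y := by
  have hA : IsWord n (toSeq x) := hx ▸ isWord_toSeq x
  have hB : IsWord n (toSeq y) := hy ▸ isWord_toSeq y
  by_contra hxy
  have hne : toSeq x ≠ toSeq y := fun heq => hxy (toSeq_injective (hx.trans hy.symm) heq)
  obtain ⟨c, hc, hwin⟩ := hA.exists_block_of_near hB hne hnear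
  have hlen := length_blockPair P x c
  have hcn : c * P ≤ n := (Nat.mul_le_mul_right P hc).trans (Nat.div_mul_le_self n P)
  refine hne <| h.eq_of_dvd_window_moments hA.isBinary hB.isBinary hw (s := c * P) (M := 2 * P)
    (m := (blockPair P x c).length) (by omega) (by omega) (fun i hi => ?_) fun k hk => ?_
  · have := hwin i hi
    omega
  · have hmod := VT_blockPair_modEq (hx.trans hy.symm) (hx ▸ hc)
      (fun i hi => ⟨(hwin i hi).1, (hwin i hi).2.1⟩) (ho k hk) (he k hk)
    have hdvd := Nat.modEq_iff_dvd.1 hmod.symm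
    rw [VT_blockPair_sub (hx.trans hy.symm) fun i hi => (hwin i hi).2.1, hx] at hdvd
    exact_mod_cast hdvd

section GlobalSyndromes

variable {n d d' e f : ℕ} {σ τ : ℤ} {x y : List Bool}

theorem eq_of_modEq_of_abs_le {a b m : ℕ} {c : ℤ} (hc : |(a : ℤ) - b| ≤ c) (hcm : c < m)
    (h : a ≡ b [MOD m]) : (a : ℤ) = b :=
  sub_eq_zero.1 <| Int.eq_zero_of_abs_lt_dvd (Nat.modEq_iff_dvd.1 h.symm) (hc.trans_lt hcm)

theorem abs_sum_le_card_mul {ι : Type*} {s : Finset ι} {f : ι → ℤ} {c : ℤ}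
    (h : ∀ i ∈ s, |f i| ≤ c) : |∑ i ∈ s, f i| ≤ s.card * c := by
  refine (Finset.abs_sum_le_sum_abs _ _).trans ((Finset.sum_le_card_nsmul _ _ _ h).trans ?_)
  rw [nsmul_eq_mul]

theorem Alignment.suffixSum_eq (h : Alignment n (toSeq x) (toSeq y) d d' e f σ τ)
    (hx : x.length = n) (hy : y.length = n) (hVT : VT 0 x ≡ VT 0 y [MOD 4]) :
    suffixSum (n + 1) (toSeq x) 0 = suffixSum (n + 1) (toSeq y) 0 := by
  have hle := h.abs_suffixSum_sub_le (isWord_toSeq x).isBinary (isWord_toSeq y).isBinary n.zero_le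
  have hVTx := hx ▸ VT_zero_eq x
  have hVTy := hy ▸ VT_zero_eq y
  rw [← hVTx, ← hVTy] at hle ⊢
  exact eq_of_modEq_of_abs_le hle (by norm_num) hVT

theorem Alignment.firstMoment_eq (h : Alignment n (toSeq x) (toSeq y) d d' e f σ τ)
    (hx : x.length = n) (hy : y.length = n) (hVT : VT 1 x ≡ VT 1 y [MOD 3 * n + 1]) :
    firstMoment (n + 1) (toSeq x) = firstMoment (n + 1) (toSeq y) := by
  have hle : |firstMoment (n + 1) (toSeq x) - firstMoment (n + 1) (toSeq y)| ≤ n * 3 := by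
    rw [← sum_suffixSum, ← sum_suffixSum, ← Finset.sum_sub_distrib]
    refine (abs_sum_le_card_mul fun j hj => h.abs_suffixSum_sub_le (isWord_toSeq x).isBinary
      (isWord_toSeq y).isBinary (by rw [Finset.mem_Ico] at hj; omega)).trans_eq ?_
    rw [Nat.card_Ico, Nat.add_sub_cancel]
  have hVTx := hx ▸ VT_one_eq x
  have hVTy := hy ▸ VT_one_eq y
  rw [← hVTx, ← hVTy] at hle ⊢
  exact eq_of_modEq_of_abs_le hle (by push_cast; linarith) hVT

theorem Alignment.suffixSum_jump_eq (h : Alignment n (toSeq x) (toSeq y) d d' e f σ τ)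
    (hx : x.length = n) (hy : y.length = n)
    (hVT : VT 0 (diffSeq x) ≡ VT 0 (diffSeq y) [MOD 7]) :
    suffixSum (n + 1) (jump (toSeq x)) 0 = suffixSum (n + 1) (jump (toSeq y)) 0 := by
  have hle := h.abs_suffixSum_jump_sub_le (isWord_toSeq x).isBinary (isWord_toSeq y).isBinary
    n.zero_le
  have hVTx := hx ▸ VT_zero_diffSeq x
  have hVTy := hy ▸ VT_zero_diffSeq y
  rw [← hVTx, ← hVTy] at hle ⊢
  exact eq_of_modEq_of_abs_le hle (by norm_num) hVT

theorem Alignment.firstMoment_jump_eq (h : Alignment n (toSeq x) (toSeq y) d d' e f σ τ)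
    (hx : x.length = n) (hy : y.length = n)
    (hVT₀ : VT 0 (diffSeq x) ≡ VT 0 (diffSeq y) [MOD 7])
    (hVT₁ : VT 1 (diffSeq x) ≡ VT 1 (diffSeq y) [MOD 6 * (n + 1) + 1]) :
    firstMoment (n + 1) (jump (toSeq x)) = firstMoment (n + 1) (jump (toSeq y)) := by
  have hw := h.suffixSum_jump_eq hx hy hVT₀
  have hVTx := hx ▸ VT_one_diffSeq x
  have hVTy := hy ▸ VT_one_diffSeq y
  have hle : |(VT 1 (diffSeq x) : ℤ) - VT 1 (diffSeq y)| ≤ n * 6 := by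
    rw [hVTx, hVTy, hw, add_sub_add_right_eq_sub, ← sum_suffixSum, ← sum_suffixSum,
      ← Finset.sum_sub_distrib]
    refine (abs_sum_le_card_mul fun j hj => h.abs_suffixSum_jump_sub_le (isWord_toSeq x).isBinary
      (isWord_toSeq y).isBinary (by rw [Finset.mem_Ico] at hj; omega)).trans_eq ?_
    rw [Nat.card_Ico, Nat.add_sub_cancel]
  have := eq_of_modEq_of_abs_le hle (by push_cast; linarith) hVT₁
  linarith

end GlobalSyndromes

section Balance

variable {l : ℕ} {x : List Bool}

theorem StrongLocallyBalanced.sum_Ico_bounds (h : StrongLocallyBalanced l (1 / 18) x) {a m : ℕ}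
    (hm : l ≤ m) (ha : a + m ≤ x.length) :
    4 * (m : ℤ) ≤ 9 * ∑ k ∈ Finset.Ico (a + 1) (a + m + 1), toSeq x k ∧
      9 * ∑ k ∈ Finset.Ico (a + 1) (a + m + 1), toSeq x k ≤ 5 * (m : ℤ) := by
  obtain ⟨hlow, hupp⟩ := h a m hm ha
  rw [← wt_take_drop x ha]
  constructor
  · have : (4 * m : ℝ) ≤ 9 * (wt ((x.drop a).take m) : ℝ) := by linarith
    exact_mod_cast this
  · have : (9 * (wt ((x.drop a).take m) : ℝ)) ≤ 5 * m := by linarith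
    exact_mod_cast this

theorem StrongLocallyBalanced.balanced (h : StrongLocallyBalanced l (1 / 18) x) :
    Balanced l (x.length + 1) (toSeq x) := by
  intro i j hi hij hj
  have := h.sum_Ico_bounds (a := i - 1) (m := j - i) (by omega) (by omega)
  rwa [show i - 1 + 1 = i by omega, show i - 1 + (j - i) + 1 = j by omega,
    Nat.cast_sub (by omega)] at this

theorem StrongLocallyBalanced.balanced_jump (h : StrongLocallyBalanced l (1 / 18) (diffSeq x)) :
    Balanced l (x.length + 1) (jump (toSeq x)) := by
  intro i j _ hij hj
  have := h.sum_Ico_bounds (a := i) (m := j - i) (by omega) (by rw [length_diffSeq]; omega)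
  rwa [show i + (j - i) + 1 = j + 1 by omega, ← Finset.sum_Ico_add' _ i j 1,
    Nat.cast_sub (by omega), Finset.sum_congr rfl fun k _ => toSeq_diffSeq x k] at this

end Balance

theorem exists_hasPeriod_le {u : List Bool} {q : ℕ} (hq : 0 < q)
    (h : ∀ i, i + q < u.length → u[i]? = u[i + q]?) : ∃ p ≤ q, HasPeriod u p := by
  classical
  have hex : ∃ q, 0 < q ∧ ∀ i, i + q < u.length → u[i]? = u[i + q]? := ⟨q, hq, h⟩
  exact ⟨Nat.find hex, Nat.find_min' hex ⟨hq, h⟩, Nat.isLeast_find hex⟩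

theorem periodBounded_of_mem_boundedPeriodic {n t : ℕ} {x : List Bool}
    (h : x ∈ boundedPeriodic n 2 t) : PeriodBounded n t (toSeq x) := by
  obtain ⟨hl, h⟩ := h
  intro a b ha hb hper
  by_cases hab : b < a
  · omega
  obtain ⟨a, rfl⟩ := Nat.exists_eq_add_of_le' ha
  obtain ⟨m, rfl⟩ := Nat.exists_eq_add_of_le (not_lt.1 hab)
  have hlen : ((x.drop a).take (m + 1)).length = m + 1 := by
    rw [List.length_take, List.length_drop]
    omega
  have hget (i : ℕ) (hi : i < m + 1) : ((x.drop a).take (m + 1))[i]? = x[a + i]? := by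
    rw [List.getElem?_take, if_pos hi, List.getElem?_drop]
  have hinfix : List.IsInfix ((x.drop a).take (m + 1)) x :=
    (List.take_prefix _ _).isInfix.trans (List.drop_suffix _ _).isInfix
  have := h _ hinfix <| exists_hasPeriod_le two_pos fun i hi => by
    rw [hlen] at hi
    have heq : x.getD (a + i) false = x.getD (a + (i + 2)) false := getD_eq_of_toSeq_eq <| by
      convert hper (a + i + 1) (by omega) (by omega) using 2
      omega
    rw [List.getD_eq_getElem _ _ (by omega), List.getD_eq_getElem _ _ (by omega)] at heq
    rw [hget i (by omega), hget (i + 2) hi, List.getElem?_eq_getElem (by omega),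
      List.getElem?_eq_getElem (by omega), heq]
  omega

section CodeParameters

variable {n : ℕ}

theorem three_le_logb (hn : 10 ≤ n) : 3 ≤ Real.logb 2 (n : ℝ) := by
  have : (10 : ℝ) ≤ n := by exact_mod_cast hn
  rw [Real.le_logb_iff_rpow_le one_lt_two (by positivity)]
  norm_num
  linarith

theorem hundred_mul_le_winLen (hn : 10 ≤ n) :
    100 * (⌈Real.logb 2 (n : ℝ)⌉₊ + 3 + 2) ≤ winLen n := by
  have hlog := three_le_logb hn
  have hwin : 1296 * Real.logb 2 (n : ℝ) ≤ winLen n := Nat.le_ceil _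
  have hceil : (⌈Real.logb 2 (n : ℝ)⌉₊ : ℝ) < Real.logb 2 (n : ℝ) + 1 :=
    Nat.ceil_lt_add_one (by linarith)
  have : (100 * (⌈Real.logb 2 (n : ℝ)⌉₊ + 3 + 2) : ℝ) ≤ winLen n := by linarith
  exact_mod_cast this

theorem farPair_of_mem_code {p : Params} {x y : List Bool} {d d' e f : ℕ} {σ τ : ℤ} (hn : 10 ≤ n)
    (hx : x ∈ code n p) (hy : y ∈ code n p) (hxy : x ≠ y)
    (h : Alignment n (toSeq x) (toSeq y) d d' e f σ τ) :
    FarPair n (winLen n) (⌈Real.logb 2 (n : ℝ)⌉₊ + 3) (toSeq x) (toSeq y) := by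
  obtain ⟨⟨hxl, hxb, hxb'⟩, hxR, hx0, hx1, hx2, hx3, hx4⟩ := hx
  obtain ⟨⟨hyl, hyb, hyb'⟩, hyR, hy0, hy1, hy2, hy3, hy4⟩ := hy
  have hw := h.suffixSum_eq hxl hyl (hx0.trans hy0.symm)
  have hw' := hx2.trans hy2.symm
  refine ⟨hundred_mul_le_winLen hn, hxl ▸ isWord_toSeq x, hyl ▸ isWord_toSeq y, hw,
    h.firstMoment_eq hxl hyl (hx1.trans hy1.symm), h.suffixSum_jump_eq hxl hyl hw',
    h.firstMoment_jump_eq hxl hyl hw' (hx3.trans hy3.symm), hxl ▸ hxb.balanced, hyl ▸ hyb.balanced,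
    hxl ▸ hxb'.balanced_jump, hyl ▸ hyb'.balanced_jump, periodBounded_of_mem_boundedPeriodic hxR,
    periodBounded_of_mem_boundedPeriodic hyR, ?_⟩
  by_contra! hnear
  exact hxy <| h.eq_of_pairVT_modEq hxl hyl hw (P := blockLen n) hnear
    (fun k hk => (hx4 ⟨k, hk⟩).1.trans (hy4 ⟨k, hk⟩).1.symm)
    fun k hk => (hx4 ⟨k, hk⟩).2.trans (hy4 ⟨k, hk⟩).2.symm

end CodeParameters

/-! ### Common words -/

/-- The words of length `m` that differ from the integer sequence `u` in at most one entry: the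
substitution ball around a word that is given by its entries. -/
def nearWords (m : ℕ) (u : ℕ → ℤ) : Set (List Bool) :=
  {z | z.length = m ∧ ∃ e, ∀ i, i ≠ e → toSeq z i = u i}

section NearWords

variable {m k : ℕ} {u v : ℕ → ℤ} {z w : List Bool}

theorem toSeq_eq_off_of_mem_nearWords (hz : z ∈ nearWords m u) (hk : toSeq z k ≠ u k) {i : ℕ}
    (hi : i ≠ k) : toSeq z i = u i := by
  obtain ⟨-, e, he⟩ := hz
  obtain rfl : k = e := not_not.1 (mt (he k) hk)
  exact he i hi

theorem eq_of_mem_nearWords_of_ne (hz : z ∈ nearWords m u) (hw : w ∈ nearWords m u)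
    (hk : toSeq z k ≠ u k) (hzw : toSeq z k = toSeq w k) : z = w := by
  refine toSeq_injective (hz.1.trans hw.1.symm) (funext fun i => ?_)
  obtain rfl | hi := eq_or_ne i k
  · exact hzw
  · rw [toSeq_eq_off_of_mem_nearWords hz hk hi, toSeq_eq_off_of_mem_nearWords hw (hzw ▸ hk) hi]

-- At a place where `u` and `v` differ, a common word differs from one of them, and so its entry
-- there determines it.
theorem encard_nearWords_inter_le (m : ℕ) (huv : u ≠ v) :
    (nearWords m u ∩ nearWords m v).encard ≤ 2 := by
  obtain ⟨k, hk⟩ := Function.ne_iff.1 huv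
  rw [← Set.encard_pair (zero_ne_one' ℤ)]
  refine Set.encard_le_encard_of_injOn (f := fun z => toSeq z k)
    (fun z _ => (isWord_toSeq z).isBinary k) fun z hz w hw hzw => ?_
  by_cases hu : toSeq z k = u k
  · exact eq_of_mem_nearWords_of_ne hz.2 hw.2 (hu ▸ hk) hzw
  · exact eq_of_mem_nearWords_of_ne hz.1 hw.1 hu hzw

end NearWords

section CommonWords

variable {n l t : ℕ} {x y z : List Bool}

theorem exists_alignment_of_mem_ball (hn : 3 ≤ n) (hx : x.length = n) (hy : y.length = n)
    (hzx : z ∈ ball x) (hzy : z ∈ ball y) :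
    ∃ d d' e f σ τ, Alignment n (toSeq x) (toSeq y) d d' e f σ τ ∧
      z ∈ nearWords (n - 1) (deleteAt (toSeq x) d) ∧
        z ∈ nearWords (n - 1) (deleteAt (toSeq y) d') := by
  obtain ⟨hz, d, hd, hdn, e, he⟩ := exists_deleteAt_of_mem_ball hzx
  obtain ⟨-, d', hd', hdn', f, hf⟩ := exists_deleteAt_of_mem_ball hzy
  obtain ⟨e₀, f₀, σ, τ, h⟩ := exists_alignment hn (hx ▸ isWord_toSeq x) (hy ▸ isWord_toSeq y)
    hd (hx ▸ hdn) hd' (hy ▸ hdn') he hf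
  exact ⟨d, d', e₀, f₀, σ, τ, h, ⟨by omega, e, he⟩, by omega, f, hf⟩

theorem FarPair.encard_ball_inter_le (H : FarPair n l t (toSeq x) (toSeq y)) (hn : 3 ≤ n)
    (hx : x.length = n) (hy : y.length = n) : (ball x ∩ ball y).encard ≤ 8 := by
  obtain ⟨c, c', hc⟩ := H.exists_four_deletions
  set S : Fin 4 → Set (List Bool) := fun k => {z | deleteAt (toSeq x) (c k) ≠
    deleteAt (toSeq y) (c' k) ∧ z ∈ nearWords (n - 1) (deleteAt (toSeq x) (c k)) ∩
      nearWords (n - 1) (deleteAt (toSeq y) (c' k))}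
  have hS (k : Fin 4) : (S k).encard ≤ 2 := by
    by_cases h : deleteAt (toSeq x) (c k) = deleteAt (toSeq y) (c' k)
    · simp [S, h]
    · exact (Set.encard_le_encard fun z hz => hz.2).trans (encard_nearWords_inter_le _ h)
  have hsub : ball x ∩ ball y ⊆ ⋃ k, S k := by
    rintro z ⟨hzx, hzy⟩
    obtain ⟨d, d', e, f, σ, τ, h, hd, hd'⟩ := exists_alignment_of_mem_ball hn hx hy hzx hzy
    obtain ⟨k, hk, hk'⟩ := hc d d' e f σ τ h
    exact Set.mem_iUnion.2 ⟨k, hk ▸ hk' ▸ H.deleteAt_ne h, hk ▸ hd, hk' ▸ hd'⟩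
  calc (ball x ∩ ball y).encard ≤ (⋃ k, S k).encard := Set.encard_le_encard hsub
    _ ≤ ∑ k, (S k).encard := Set.encard_iUnion_le_of_fintype S
    _ ≤ ∑ _k : Fin 4, 2 := Finset.sum_le_sum fun k _ => hS k
    _ = 8 := by norm_num

end CommonWords

theorem isReconstructionCode_code {n : ℕ} (hn : 10 ≤ n) (p : Params) :
    IsReconstructionCode n 9 (code n p) := by
  refine ⟨fun x hx => hx.1.1, fun x hx y hy hxy => ?_⟩
  have hxl : x.length = n := hx.1.1
  have hyl : y.length = n := hy.1.1
  obtain hempty | ⟨z, hzx, hzy⟩ := (ball x ∩ ball y).eq_empty_or_nonempty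
  · simp [hempty]
  obtain ⟨d, d', e, f, σ, τ, h, -⟩ := exists_alignment_of_mem_ball (by omega) hxl hyl hzx hzy
  refine ((farPair_of_mem_code hn hx hy hxy h).encard_ball_inter_le (by omega) hxl hyl).trans_lt ?_
  norm_num

/-! ### Counting words -/

/-- All words of length `n`. -/
noncomputable def words (n : ℕ) : Finset (List Bool) := (List.finite_length_eq Bool n).toFinset

theorem mem_words {n : ℕ} {x : List Bool} : x ∈ words n ↔ x.length = n := by
  simp [words]

theorem sum_words_succ (n : ℕ) (g : List Bool → ℝ) :
    ∑ u ∈ words (n + 1), g u = ∑ u ∈ words n, (g (false :: u) + g (true :: u)) := by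
  classical
  have hdisj : Disjoint ((words n).image (List.cons false)) ((words n).image (List.cons true)) := by
    simp [Finset.disjoint_left]
  have hwords : words (n + 1) =
      (words n).image (List.cons false) ∪ (words n).image (List.cons true) := by
    ext x
    rcases x with _ | ⟨_ | _, u⟩ <;> simp [mem_words]
  rw [hwords, Finset.sum_union hdisj, Finset.sum_image (by simp), Finset.sum_image (by simp),
    Finset.sum_add_distrib]

theorem sum_pow_wt (n : ℕ) (c : ℝ) : ∑ u ∈ words n, c ^ wt u = (1 + c) ^ n := by
  induction n with
  | zero =>
    have : words 0 = {[]} := by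
      ext x
      simp [mem_words]
    simp [this, wt]
  | succ n ih =>
    rw [sum_words_succ, pow_succ, ← ih, Finset.sum_mul]
    refine Finset.sum_congr rfl fun u _ => ?_
    simp only [wt, List.count_cons_self, pow_succ, List.count_cons_of_ne Bool.false_ne_true]
    ring

theorem card_words (n : ℕ) : (words n).card = 2 ^ n := by
  have h := sum_pow_wt n 1
  norm_num at h
  exact_mod_cast h

theorem card_filter_window_le (Q : List Bool → Prop) [DecidablePred Q] {n i m : ℕ}
    (h : i + m ≤ n) :
    ((words n).filter fun x => Q ((x.drop i).take m)).card ≤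
      2 ^ (n - m) * ((words m).filter Q).card := by
  rw [← card_words, ← Finset.card_product]
  refine Finset.card_le_card_of_injOn
    (fun x => (x.take i ++ x.drop (i + m), (x.drop i).take m)) (fun x hx => ?_)
    fun x hx y hy hxy => ?_
  · obtain ⟨hx, hQ⟩ := Finset.mem_filter.1 hx
    rw [mem_words] at hx
    simp only [Finset.coe_product, Set.mem_prod, Finset.mem_coe, Finset.mem_filter, mem_words,
      List.length_append, List.length_take, List.length_drop]
    exact ⟨by omega, by omega, hQ⟩
  · have hx := mem_words.1 (Finset.mem_filter.1 hx).1
    have hy := mem_words.1 (Finset.mem_filter.1 hy).1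
    obtain ⟨hrest, hwindow⟩ := Prod.mk.inj hxy
    obtain ⟨hleft, hright⟩ := List.append_inj hrest (by simp only [List.length_take]; omega)
    rw [← List.take_append_drop i x, ← List.take_append_drop i y, hleft,
      ← List.take_append_drop m (x.drop i), ← List.take_append_drop m (y.drop i), hwindow,
      List.drop_drop, List.drop_drop, hright]

theorem card_le_of_exists_window (Q : List Bool → Prop) [DecidablePred Q] {N : ℕ} {r : ℝ}
    {s : Finset (List Bool)} {T : Finset (ℕ × ℕ)} (hs : s ⊆ words N)
    (hT : ∀ p ∈ T, p.1 + p.2 ≤ N) (hsT : ∀ x ∈ s, ∃ p ∈ T, Q ((x.drop p.1).take p.2))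
    (hQ : ∀ p ∈ T, ((words p.2).filter Q).card ≤ 2 ^ p.2 * r) :
    s.card ≤ T.card * (2 ^ N * r) := by
  classical
  set F : ℕ × ℕ → Finset (List Bool) := fun p =>
    (words N).filter fun x => Q ((x.drop p.1).take p.2)
  have hF : ∀ p ∈ T, ((F p).card : ℝ) ≤ 2 ^ N * r := fun p hp =>
    calc ((F p).card : ℝ) ≤ 2 ^ (N - p.2) * ((words p.2).filter Q).card := by
          exact_mod_cast card_filter_window_le Q (hT p hp)
      _ ≤ 2 ^ (N - p.2) * (2 ^ p.2 * r) := by gcongr; exact hQ p hp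
      _ = 2 ^ N * r := by
          rw [← mul_assoc, ← pow_add, Nat.sub_add_cancel (le_of_add_le_right (hT p hp))]
  have hsub : s ⊆ T.biUnion F := fun x hx => by
    obtain ⟨p, hp, hpx⟩ := hsT x hx
    exact Finset.mem_biUnion.2 ⟨p, hp, Finset.mem_filter.2 ⟨hs hx, hpx⟩⟩
  calc (s.card : ℝ) ≤ ∑ p ∈ T, ((F p).card : ℝ) := by
        exact_mod_cast (Finset.card_le_card hsub).trans Finset.card_biUnion_le
    _ ≤ T.card * (2 ^ N * r) := by
        rw [← nsmul_eq_mul]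
        exact Finset.sum_le_card_nsmul _ _ _ hF

/-! ### Unbalanced words -/

-- The Chernoff bound: Markov's inequality for `c ^ wt u`.
theorem card_filter_le_pow (Q : List Bool → Prop) [DecidablePred Q] {m : ℕ} {c b r : ℝ}
    (hc : 0 ≤ c) (hb : 0 < b) (hr : 1 + c ≤ r * b)
    (hQ : ∀ u ∈ words m, Q u → b ^ m ≤ c ^ wt u) : ((words m).filter Q).card ≤ r ^ m := by
  have hsum : ((words m).filter Q).card * b ^ m ≤ r ^ m * b ^ m :=
    calc ((words m).filter Q).card * b ^ m ≤ ∑ u ∈ (words m).filter Q, c ^ wt u := by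
          rw [← nsmul_eq_mul]
          exact Finset.card_nsmul_le_sum _ _ _ fun u hu =>
            hQ u (Finset.mem_filter.1 hu).1 (Finset.mem_filter.1 hu).2
      _ ≤ ∑ u ∈ words m, c ^ wt u :=
          Finset.sum_le_sum_of_subset_of_nonneg (Finset.filter_subset _ _) fun u _ _ => by
            positivity
      _ = (1 + c) ^ m := sum_pow_wt m c
      _ ≤ r ^ m * b ^ m := by
          rw [← mul_pow]
          gcongr
  exact le_of_mul_le_mul_right hsum (by positivity)

/-- The weight of `u` is less than `4/9` or more than `5/9` of its length. -/
abbrev IsUnbalanced (u : List Bool) : Prop :=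
  9 * wt u < 4 * u.length ∨ 5 * u.length < 9 * wt u

-- The optimal weights are `4 / 5` and its inverse; nearby ninth powers of rationals keep the
-- estimate free of roots.
theorem card_filter_isUnbalanced_le (m : ℕ) :
    ((words m).filter IsUnbalanced).card ≤ 2 ^ m * (2 * (994 / 1000 : ℝ) ^ m) := by
  have hlight : ((words m).filter fun u => 9 * wt u < 4 * u.length).card ≤
      (2 * (994 / 1000) : ℝ) ^ m := by
    refine card_filter_le_pow _ (c := (40 / 41) ^ 9) (b := (40 / 41) ^ 4) (by positivity)
      (by positivity) (by norm_num) fun u hu hlt => ?_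
    rw [mem_words.1 hu] at hlt
    rw [← pow_mul, ← pow_mul]
    exact pow_le_pow_of_le_one (by norm_num) (by norm_num) hlt.le
  have hheavy : ((words m).filter fun u => 5 * u.length < 9 * wt u).card ≤
      (2 * (994 / 1000) : ℝ) ^ m := by
    refine card_filter_le_pow _ (c := (41 / 40) ^ 9) (b := (41 / 40) ^ 5) (by positivity)
      (by positivity) (by norm_num) fun u hu hlt => ?_
    rw [mem_words.1 hu] at hlt
    rw [← pow_mul, ← pow_mul]
    exact pow_le_pow_right₀ (by norm_num) hlt.le
  have hunion : (((words m).filter IsUnbalanced).card : ℝ) ≤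
      ((words m).filter fun u => 9 * wt u < 4 * u.length).card +
        ((words m).filter fun u => 5 * u.length < 9 * wt u).card := by
    rw [Finset.filter_or]
    exact_mod_cast Finset.card_union_le _ _
  rw [mul_pow] at hlight hheavy
  linarith

theorem exists_isUnbalanced_window {l : ℕ} {x : List Bool}
    (h : ¬StrongLocallyBalanced l (1 / 18) x) :
    ∃ i m, l ≤ m ∧ i + m ≤ x.length ∧ IsUnbalanced ((x.drop i).take m) := by
  unfold StrongLocallyBalanced at h
  push Not at h
  obtain ⟨i, m, hm, him, h⟩ := h
  have hlen : ((x.drop i).take m).length = m := by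
    rw [List.length_take, List.length_drop]
    omega
  refine ⟨i, m, hm, him, ?_⟩
  by_contra! hbal
  rw [hlen] at hbal
  have hlow : (4 * m : ℝ) ≤ 9 * wt ((x.drop i).take m) := by exact_mod_cast hbal.1
  have hupp : (9 * wt ((x.drop i).take m) : ℝ) ≤ 5 * m := by exact_mod_cast hbal.2
  linarith [h (by linarith)]

open scoped Classical in
theorem card_not_strongLocallyBalanced_le (N l : ℕ) :
    ((words N).filter fun x => ¬StrongLocallyBalanced l (1 / 18) x).card ≤
      ((N : ℝ) + 1) ^ 2 * (2 ^ N * (2 * (994 / 1000) ^ l)) := by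
  set T := (Finset.range (N + 1) ×ˢ Finset.range (N + 1)).filter
    fun p => l ≤ p.2 ∧ p.1 + p.2 ≤ N
  have hT : (T.card : ℝ) ≤ (N + 1) ^ 2 := by
    have := Finset.card_filter_le (Finset.range (N + 1) ×ˢ Finset.range (N + 1))
      fun p => l ≤ p.2 ∧ p.1 + p.2 ≤ N
    rw [Finset.card_product, Finset.card_range, ← sq] at this
    exact_mod_cast this
  refine (card_le_of_exists_window IsUnbalanced (T := T) (r := 2 * (994 / 1000) ^ l)
    (Finset.filter_subset _ _) (fun p hp => (Finset.mem_filter.1 hp).2.2) (fun x hx => ?_)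
    fun p hp => (card_filter_isUnbalanced_le p.2).trans ?_).trans (by gcongr)
  · obtain ⟨hx, hbal⟩ := Finset.mem_filter.1 hx
    obtain ⟨i, m, hm, him, hu⟩ := exists_isUnbalanced_window hbal
    rw [mem_words.1 hx] at him
    refine ⟨(i, m), ?_, hu⟩
    simp only [T, Finset.mem_filter, Finset.mem_product, Finset.mem_range]
    omega
  · gcongr 2 ^ _ * (2 * ?_)
    exact pow_le_pow_of_le_one (by norm_num) (by norm_num) (Finset.mem_filter.1 hp).2.1

theorem diffSeq_injective : Function.Injective diffSeq := by
  intro x y h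
  have hl : x.length + 1 = y.length + 1 := by rw [← length_diffSeq, h, length_diffSeq]
  refine toSeq_injective (Nat.succ_injective hl) (funext fun i => ?_)
  induction i with
  | zero => rfl
  | succ i ih =>
    have hjump : jump (toSeq x) i = jump (toSeq y) i := by rw [← toSeq_diffSeq, h, toSeq_diffSeq]
    rw [jump, jump, ih] at hjump
    rcases (isWord_toSeq y).isBinary i with hy | hy <;>
      rcases (isWord_toSeq x).isBinary (i + 1) with hx' | hx' <;>
      rcases (isWord_toSeq y).isBinary (i + 1) with hy' | hy' <;>
      simp_all

theorem rate_pow_winLen_le {n : ℕ} (hn : 10 ≤ n) :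
    (994 / 1000 : ℝ) ^ winLen n ≤ 1 / (n : ℝ) ^ 4 := by
  have hn0 : (0 : ℝ) < n := by positivity
  have hlog := three_le_logb hn
  have hwin : 1296 * Real.logb 2 (n : ℝ) ≤ winLen n := Nat.le_ceil _
  calc (994 / 1000 : ℝ) ^ winLen n = (994 / 1000 : ℝ) ^ (winLen n : ℝ) :=
        (Real.rpow_natCast _ _).symm
    _ ≤ (994 / 1000 : ℝ) ^ (((162 : ℕ) : ℝ) * (4 * Real.logb 2 (n : ℝ))) :=
        Real.rpow_le_rpow_of_exponent_ge (by norm_num) (by norm_num) (by push_cast; linarith)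
    _ = ((994 / 1000 : ℝ) ^ 162) ^ (4 * Real.logb 2 (n : ℝ)) := by
        rw [Real.rpow_mul (by norm_num), Real.rpow_natCast]
    _ ≤ (1 / 2 : ℝ) ^ (4 * Real.logb 2 (n : ℝ)) :=
        Real.rpow_le_rpow (by positivity) (by norm_num) (by linarith)
    _ = 1 / (n : ℝ) ^ 4 := by
        rw [one_div, Real.inv_rpow two_pos.le, mul_comm, Real.rpow_mul two_pos.le,
          Real.rpow_logb two_pos one_lt_two.ne' hn0, one_div]
        norm_cast

open scoped Classical in
theorem card_not_strongLocallyBalanced_winLen_le {n N : ℕ} (hn : 10 ≤ n) (hN : N ≤ n + 1) :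
    ((words N).filter fun x => ¬StrongLocallyBalanced (winLen n) (1 / 18) x).card ≤
      (2 : ℝ) ^ N / 32 := by
  have hn' : (10 : ℝ) ≤ n := by exact_mod_cast hn
  have hN' : (N : ℝ) + 1 ≤ 6 / 5 * n := by
    have : (N : ℝ) ≤ n + 1 := by exact_mod_cast hN
    linarith
  calc (((words N).filter fun x => ¬StrongLocallyBalanced (winLen n) (1 / 18) x).card : ℝ)
      ≤ ((N : ℝ) + 1) ^ 2 * (2 ^ N * (2 * (994 / 1000) ^ winLen n)) :=
        card_not_strongLocallyBalanced_le N _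
    _ ≤ (6 / 5 * n) ^ 2 * (2 ^ N * (2 * (1 / (n : ℝ) ^ 4))) := by
        gcongr
        exact rate_pow_winLen_le hn
    _ = 2 ^ N * (72 / 25 / (n : ℝ) ^ 2) := by field_simp; norm_num
    _ ≤ 2 ^ N * (72 / 25 / 10 ^ 2) := by gcongr
    _ ≤ 2 ^ N / 32 := by linarith [pow_pos (two_pos (α := ℝ)) N]

open scoped Classical in
theorem card_not_strongLocallyBalanced_diffSeq_le {n : ℕ} (hn : 10 ≤ n) :
    ((words n).filter fun x => ¬StrongLocallyBalanced (winLen n) (1 / 18) (diffSeq x)).card ≤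
      (2 : ℝ) ^ (n + 1) / 32 := by
  refine le_trans ?_ (card_not_strongLocallyBalanced_winLen_le hn le_rfl)
  refine Nat.cast_le.2 (Finset.card_le_card_of_injOn diffSeq (fun x hx => ?_)
    diffSeq_injective.injOn)
  obtain ⟨hx, hbal⟩ := Finset.mem_filter.1 hx
  rw [mem_words] at hx
  exact Finset.mem_coe.2 (Finset.mem_filter.2 ⟨by rw [mem_words, length_diffSeq, hx], hbal⟩)

/-! ### Words with long periodic windows -/

/-- The entries of `u` are invariant under a shift by two, that is, `u` has period one or two. -/
def IsTwoPeriodic (u : List Bool) : Prop := ∀ i, i + 2 < u.length → u[i]? = u[i + 2]?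

theorem HasPeriod.isTwoPeriodic {u : List Bool} {p : ℕ} (h : HasPeriod u p) (hp : p ≤ 2) :
    IsTwoPeriodic u := by
  obtain ⟨⟨hp0, h⟩, -⟩ := h
  intro i hi
  obtain rfl | rfl : p = 1 ∨ p = 2 := by omega
  · rw [h i (by omega), h (i + 1) (by omega)]
  · exact h i hi

theorem IsTwoPeriodic.take {u : List Bool} (h : IsTwoPeriodic u) (m : ℕ) :
    IsTwoPeriodic (u.take m) := by
  intro i hi
  rw [List.length_take] at hi
  rw [List.getElem?_take, List.getElem?_take, if_pos (by omega), if_pos (by omega)]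
  exact h i (by omega)

theorem IsTwoPeriodic.eq_of_take_eq {u v : List Bool} (hu : IsTwoPeriodic u)
    (hv : IsTwoPeriodic v) (hl : u.length = v.length) (h : u.take 2 = v.take 2) : u = v := by
  have hget (i : ℕ) (hi : i < 2) : u[i]? = v[i]? := by
    rw [← List.getElem?_take_of_lt hi, h, List.getElem?_take_of_lt hi]
  refine List.ext_getElem? fun i => ?_
  induction i using Nat.twoStepInduction with
  | zero => exact hget 0 two_pos
  | one => exact hget 1 one_lt_two
  | more i ih _ =>
    obtain hi | hi := Nat.lt_or_ge (i + 2) u.length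
    · rw [← hu i hi, ← hv i (hl ▸ hi), ih]
    · rw [List.getElem?_eq_none hi, List.getElem?_eq_none (hl ▸ hi)]

open scoped Classical in
theorem card_filter_isTwoPeriodic_le (m : ℕ) : ((words m).filter IsTwoPeriodic).card ≤ 4 := by
  have hinj : ((words m).filter IsTwoPeriodic).card ≤ (words (min 2 m)).card := by
    refine Finset.card_le_card_of_injOn (List.take 2) (fun u hu => ?_) fun u hu v hv h => ?_
    · have hu := mem_words.1 (Finset.mem_filter.1 hu).1
      rw [Finset.mem_coe, mem_words, List.length_take, hu]
    · obtain ⟨hu, hu'⟩ := Finset.mem_filter.1 hu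
      obtain ⟨hv, hv'⟩ := Finset.mem_filter.1 hv
      exact hu'.eq_of_take_eq hv' ((mem_words.1 hu).trans (mem_words.1 hv).symm) h
  rw [card_words] at hinj
  exact hinj.trans (Nat.pow_le_pow_right two_pos (min_le_left 2 m))

theorem exists_isTwoPeriodic_window {t : ℕ} {x : List Bool}
    (h : x ∉ boundedPeriodic x.length 2 t) :
    ∃ i, i + (t + 1) ≤ x.length ∧ IsTwoPeriodic ((x.drop i).take (t + 1)) := by
  obtain ⟨u, hux, ⟨p, hp, hper⟩, hu⟩ :
      ∃ u, List.IsInfix u x ∧ (∃ p ≤ 2, HasPeriod u p) ∧ t < u.length := by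
    by_contra! hshort
    exact h ⟨rfl, hshort⟩
  obtain ⟨s, r, rfl⟩ := hux
  refine ⟨s.length, by simp only [List.length_append]; omega, ?_⟩
  rw [List.append_assoc, List.drop_left, List.take_append_of_le_length hu]
  exact (hper.isTwoPeriodic hp).take _

open scoped Classical in
theorem card_not_boundedPeriodic_le (n t : ℕ) :
    ((words n).filter fun x => x ∉ boundedPeriodic n 2 t).card ≤
      (n : ℝ) * (2 ^ n * (4 / 2 ^ (t + 1))) := by
  refine (card_le_of_exists_window IsTwoPeriodic (T := Finset.range (n - t) ×ˢ {t + 1})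
    (r := 4 / 2 ^ (t + 1)) (Finset.filter_subset _ _) (fun p hp => ?_) (fun x hx => ?_)
    fun p hp => ?_).trans ?_
  · simp only [Finset.mem_product, Finset.mem_range, Finset.mem_singleton] at hp
    omega
  · obtain ⟨hx, hper⟩ := Finset.mem_filter.1 hx
    obtain rfl := mem_words.1 hx
    obtain ⟨i, hi, hu⟩ := exists_isTwoPeriodic_window hper
    exact ⟨(i, t + 1), Finset.mem_product.2
      ⟨Finset.mem_range.2 (Nat.lt_sub_of_add_lt hi), Finset.mem_singleton_self _⟩, hu⟩
  · obtain ⟨i, m⟩ := p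
    obtain rfl : m = t + 1 := Finset.mem_singleton.1 (Finset.mem_product.1 hp).2
    rw [mul_div_cancel₀ _ (by positivity)]
    exact_mod_cast card_filter_isTwoPeriodic_le (t + 1)
  · rw [Finset.card_product, Finset.card_range, Finset.card_singleton, mul_one]
    gcongr
    exact Nat.sub_le n t

open scoped Classical in
theorem card_not_boundedPeriodic_log_le {n : ℕ} (hn : 0 < n) :
    ((words n).filter fun x => x ∉ boundedPeriodic n 2 (⌈Real.logb 2 (n : ℝ)⌉₊ + 3)).card ≤
      (2 : ℝ) ^ n / 4 := by
  have hn' : (0 : ℝ) < n := by exact_mod_cast hn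
  have hpow : (n : ℝ) ≤ 2 ^ ⌈Real.logb 2 (n : ℝ)⌉₊ := by
    rw [← Real.rpow_natCast, ← Real.logb_le_iff_le_rpow one_lt_two hn']
    exact Nat.le_ceil _
  refine (card_not_boundedPeriodic_le n _).trans ?_
  calc (n : ℝ) * (2 ^ n * (4 / 2 ^ (⌈Real.logb 2 (n : ℝ)⌉₊ + 3 + 1)))
      = n / 2 ^ ⌈Real.logb 2 (n : ℝ)⌉₊ * (2 ^ n / 4) := by
        rw [pow_add, pow_add]
        field_simp
        norm_num
    _ ≤ 1 * (2 ^ n / 4) := by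
        gcongr
        exact div_le_one_of_le₀ hpow (by positivity)
    _ = 2 ^ n / 4 := one_mul _

/-! ### Redundancy -/

open scoped Classical in
/-- The words that satisfy all constraints of `code` that do not involve residues. -/
noncomputable def constrainedWords (n : ℕ) : Finset (List Bool) :=
  (words n).filter fun x =>
    x ∈ balancedSet n ∧ x ∈ boundedPeriodic n 2 (⌈Real.logb 2 (n : ℝ)⌉₊ + 3)

theorem mem_constrainedWords {n : ℕ} {x : List Bool} : x ∈ constrainedWords n ↔
    x ∈ balancedSet n ∧ x ∈ boundedPeriodic n 2 (⌈Real.logb 2 (n : ℝ)⌉₊ + 3) := by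
  classical
  exact Finset.mem_filter.trans (and_iff_right_of_imp fun h => mem_words.2 h.1.1)

theorem half_le_card_constrainedWords {n : ℕ} (hn : 10 ≤ n) :
    (2 : ℝ) ^ n / 2 ≤ (constrainedWords n).card := by
  classical
  have h₁ := card_not_strongLocallyBalanced_winLen_le hn n.le_succ
  have h₂ := card_not_strongLocallyBalanced_diffSeq_le hn
  have h₃ := card_not_boundedPeriodic_log_le (n := n) (by omega)
  set B₁ := (words n).filter fun x => ¬StrongLocallyBalanced (winLen n) (1 / 18) x
  set B₂ := (words n).filter fun x => ¬StrongLocallyBalanced (winLen n) (1 / 18) (diffSeq x)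
  set B₃ := (words n).filter fun x => x ∉ boundedPeriodic n 2 (⌈Real.logb 2 (n : ℝ)⌉₊ + 3)
  have hcover : words n ⊆ constrainedWords n ∪ (B₁ ∪ (B₂ ∪ B₃)) := by
    intro x hx
    simp only [Finset.mem_union, mem_constrainedWords, balancedSet, Set.mem_ofPred_eq, B₁, B₂, B₃,
      Finset.mem_filter, hx, mem_words.1 hx, true_and]
    tauto
  have hcard : (2 : ℝ) ^ n ≤ (constrainedWords n).card + (B₁.card + (B₂.card + B₃.card)) := by
    have := (Finset.card_le_card hcover).trans <| (Finset.card_union_le _ _).trans <|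
      add_le_add_right ((Finset.card_union_le _ _).trans <|
        add_le_add_right (Finset.card_union_le _ _) _) _
    rw [card_words] at this
    exact_mod_cast this
  rw [pow_succ] at h₂
  have := pow_pos (two_pos (α := ℝ)) n
  linarith

/-- The modulus of the block constraints of order `k + 1`. -/
noncomputable def blockMod (n : ℕ) (k : Fin 3) : ℕ := 3 * (2 * blockLen n) ^ (k.val + 1)

theorem winLen_pos {n : ℕ} (hn : 10 ≤ n) : 0 < winLen n := by
  have := hundred_mul_le_winLen hn
  omega

theorem blockMod_pos {n : ℕ} (hn : 10 ≤ n) (k : Fin 3) : 0 < blockMod n k := by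
  have := winLen_pos hn
  unfold blockMod blockLen
  positivity

/-- The tuples of residues, one for each choice of parameters in range. -/
abbrev Residues (n : ℕ) : Type :=
  Fin 4 × Fin (3 * n + 1) × Fin 7 × Fin (6 * (n + 1) + 1) ×
    ((k : Fin 3) → Fin (blockMod n k)) × ((k : Fin 3) → Fin (blockMod n k))

/-- The residues of a word. -/
noncomputable def residues {n : ℕ} (hn : 10 ≤ n) (x : List Bool) : Residues n :=
  (⟨VT 0 x % 4, Nat.mod_lt _ (by norm_num)⟩,
    ⟨VT 1 x % (3 * n + 1), Nat.mod_lt _ (by omega)⟩,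
    ⟨VT 0 (diffSeq x) % 7, Nat.mod_lt _ (by norm_num)⟩,
    ⟨VT 1 (diffSeq x) % (6 * (n + 1) + 1), Nat.mod_lt _ (by omega)⟩,
    fun k => ⟨oddPairVT (blockLen n) (k.val + 1) x % blockMod n k,
      Nat.mod_lt _ (blockMod_pos hn k)⟩,
    fun k => ⟨evenPairVT (blockLen n) (k.val + 1) x % blockMod n k,
      Nat.mod_lt _ (blockMod_pos hn k)⟩)

/-- The parameters given by a tuple of residues. -/
def Residues.toParams {n : ℕ} (r : Residues n) : Params :=
  ⟨r.1, r.2.1, r.2.2.1, r.2.2.2.1, fun k => r.2.2.2.2.1 k, fun k => r.2.2.2.2.2 k⟩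

theorem Residues.inRange_toParams {n : ℕ} (r : Residues n) : r.toParams.InRange n :=
  ⟨Nat.le_of_lt_succ r.1.2, Nat.le_of_lt_succ r.2.1.2, Nat.le_of_lt_succ r.2.2.1.2,
    Nat.le_of_lt_succ r.2.2.2.1.2, fun k => ⟨(r.2.2.2.2.1 k).2, (r.2.2.2.2.2 k).2⟩⟩

theorem mem_code_residues {n : ℕ} (hn : 10 ≤ n) {x : List Bool} (hx : x ∈ constrainedWords n) :
    x ∈ code n (Residues.toParams (residues hn x)) := by
  obtain ⟨hbal, hper⟩ := mem_constrainedWords.1 hx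
  exact ⟨hbal, hper, (Nat.mod_modEq _ _).symm, (Nat.mod_modEq _ _).symm,
    (Nat.mod_modEq _ _).symm, (Nat.mod_modEq _ _).symm,
    fun _ => ⟨(Nat.mod_modEq _ _).symm, (Nat.mod_modEq _ _).symm⟩⟩

theorem card_residues (n : ℕ) : Fintype.card (Residues n) =
    4 * ((3 * n + 1) * (7 * ((6 * (n + 1) + 1) * (27 * (2 * blockLen n) ^ 6) ^ 2))) := by
  have hpi : Fintype.card ((k : Fin 3) → Fin (blockMod n k)) = 27 * (2 * blockLen n) ^ 6 := by
    rw [Fintype.card_pi, Fin.prod_univ_three, Fintype.card_fin, Fintype.card_fin, Fintype.card_fin]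
    simp only [blockMod, Fin.val_zero, Fin.val_one, Fin.val_two]
    ring
  simp only [Fintype.card_prod, hpi, Fintype.card_fin]
  ring

theorem two_mul_blockLen_le {n : ℕ} (hn : 10 ≤ n) :
    (2 * blockLen n : ℝ) ≤ 10376 * Real.logb 2 (n : ℝ) := by
  have hlog := three_le_logb hn
  have hwin : (winLen n : ℝ) < 1296 * Real.logb 2 (n : ℝ) + 1 :=
    Nat.ceil_lt_add_one (by linarith)
  unfold blockLen
  push_cast
  linarith

theorem card_residues_le {n : ℕ} (hn : 10 ≤ n) : (Fintype.card (Residues n) : ℝ) ≤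
    784 * 27 ^ 2 * 10376 ^ 12 * ((n : ℝ) ^ 2 * Real.logb 2 (n : ℝ) ^ 12) := by
  have hn' : (10 : ℝ) ≤ n := by exact_mod_cast hn
  have hblock := two_mul_blockLen_le hn
  rw [card_residues]
  push_cast
  calc (4 * ((3 * n + 1) * (7 * ((6 * (n + 1) + 1) * (27 * (2 * blockLen n) ^ 6) ^ 2))) : ℝ)
      ≤ 4 * ((4 * n) * (7 * ((7 * n) * (27 * (10376 * Real.logb 2 (n : ℝ)) ^ 6) ^ 2))) := by
        gcongr <;> linarith
    _ = 784 * 27 ^ 2 * 10376 ^ 12 * ((n : ℝ) ^ 2 * Real.logb 2 (n : ℝ) ^ 12) := by ring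

theorem finite_code (n : ℕ) (p : Params) : (code n p).Finite :=
  (List.finite_length_eq Bool n).subset fun _ hx => hx.1.1

theorem exists_le_ncard_code {n : ℕ} (hn : 10 ≤ n) : ∃ p : Params, p.InRange n ∧
    (2 : ℝ) ^ n / 2 / Fintype.card (Residues n) ≤ (code n p).ncard := by
  classical
  have : Nonempty (Residues n) := ⟨residues hn []⟩
  obtain ⟨r, -, hr⟩ := Finset.exists_le_card_fiber_of_nsmul_le_card_of_maps_to
    (s := constrainedWords n) (t := Finset.univ) (f := residues hn)
    (b := (2 : ℝ) ^ n / 2 / Fintype.card (Residues n)) (fun _ _ => Finset.mem_univ _)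
    Finset.univ_nonempty <| by
      rw [nsmul_eq_mul, Finset.card_univ, mul_div_cancel₀ _ (by positivity)]
      exact half_le_card_constrainedWords hn
  refine ⟨Residues.toParams r, r.inRange_toParams, hr.trans ?_⟩
  rw [← Set.ncard_coe_finset]
  refine Nat.cast_le.2 (Set.ncard_le_ncard (fun x hx => ?_) (finite_code n _))
  obtain ⟨hxc, rfl⟩ := Finset.mem_filter.1 (Finset.mem_coe.1 hx)
  exact mem_code_residues hn hxc

theorem exists_code_large {n : ℕ} (hn : 10 ≤ n) : ∃ p : Params, p.InRange n ∧
    (2 : ℝ) ^ n / (2 * (784 * 27 ^ 2 * 10376 ^ 12) * ((n : ℝ) ^ 2 * Real.logb 2 (n : ℝ) ^ 12)) ≤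
      (code n p).ncard := by
  obtain ⟨p, hp, hcard⟩ := exists_le_ncard_code hn
  have : Nonempty (Residues n) := ⟨residues hn []⟩
  refine ⟨p, hp, le_trans ?_ hcard⟩
  rw [div_div, mul_assoc 2]
  gcongr
  exact card_residues_le hn

theorem redundancy_le_logb {n : ℕ} {C : Set (List Bool)} {M : ℝ} (hM : 0 < M)
    (h : (2 : ℝ) ^ n / M ≤ C.ncard) : redundancy n C ≤ Real.logb 2 M := by
  have hlog := Real.logb_le_logb_of_le one_lt_two (by positivity) h
  rw [Real.logb_div (by positivity) hM.ne', Real.logb_pow, Real.logb_self_eq_one one_lt_two,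
    mul_one] at hlog
  unfold redundancy
  linarith

theorem logb_mul_sq_mul_pow {c a b : ℝ} (hc : 0 < c) (ha : 0 < a) (hb : 0 < b) :
    Real.logb 2 (c * (a ^ 2 * b ^ 12)) =
      2 * Real.logb 2 a + 12 * Real.logb 2 b + Real.logb 2 c := by
  rw [Real.logb_mul hc.ne' (by positivity), Real.logb_mul (by positivity) (by positivity),
    Real.logb_pow, Real.logb_pow, add_comm]
  norm_cast

end DelSub

theorem theorem7 :
    (∀ n : ℕ, 10 ≤ n → ∀ p : DelSub.Params, p.InRange n →
      DelSub.IsReconstructionCode n 9 (DelSub.code n p)) ∧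
    ∃ K : ℝ, ∀ n : ℕ, 10 ≤ n → ∃ p : DelSub.Params, p.InRange n ∧
      (DelSub.code n p).Nonempty ∧
      DelSub.redundancy n (DelSub.code n p) ≤
        2 * Real.logb 2 (n : ℝ) + 12 * Real.logb 2 (Real.logb 2 (n : ℝ)) + K := by
  refine ⟨fun n hn p _ => DelSub.isReconstructionCode_code hn p,
    Real.logb 2 (2 * (784 * 27 ^ 2 * 10376 ^ 12)), fun n hn => ?_⟩
  have hn0 : (0 : ℝ) < n := by positivity
  have hlog : 0 < Real.logb 2 (n : ℝ) := three_pos.trans_le (DelSub.three_le_logb hn)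
  obtain ⟨p, hp, hcard⟩ := DelSub.exists_code_large hn
  refine ⟨p, hp, ?_, ?_⟩
  · have : (0 : ℝ) < (DelSub.code n p).ncard := lt_of_lt_of_le (by positivity) hcard
    exact Set.nonempty_of_ncard_ne_zero (Nat.cast_pos.1 this).ne'
  · refine (DelSub.redundancy_le_logb (by positivity) hcard).trans_eq ?_
    exact DelSub.logb_mul_sq_mul_pow (by positivity) hn0 hlog
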